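/- Setting. Let $\mathbb X$ be a smooth, compact, connected Riemannian manifold without boundary, with geodesic distance $\rho$ and closed balls $B(x,r)$, let $\mu$ be a Borel probability measure on $\mathbb X$, and let $\alpha>0$ satisfy $\mu(B(x,r))\le c\,r^\alpha$ for all $x\in\mathbb X$, $r>0$. Let $\{\phi_j\}_{j\ge 0}$ be continuous real functions on $\mathbb X$, orthonormal in $L^2(\mu)$, with $\phi_0\equiv 1$, and let $0=\ell_0\le\ell_1\le\cdots$ with $\ell_j\to\infty$. Put $$K_t(x,y)=\sum_{j\ge0}e^{-\ell_j^2t}\phi_j(x)\phi_j(y),\qquad \Pi_L=\mathrm{span}\{\phi_j:\ell_j\le L\}.$$ Assume that for all $t\in(0,1]$ and $x,y\in\mathbb X$ the series converges and, with positive constants $c,c_1$ independent of $t,x,y$ (possibly different in each condition), * $\int_{\mathbb X}K_t(x,z)\,d\mu(z)=1$ and $|K_t(x,y)|\le c_1t^{-\alpha/2}\exp(-c\rho(x,y)^2/t)$; * $K_t(x,\cdot)$ is differentiable and $|\partial_yK_t(x,y)|\le c_1t^{-\alpha/2-1}\exp(-c\rho(x,y)^2/t)$ for every derivative $\partial_y$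 in the direction of a unit tangent vector at $y$; * (heat kernel lower bound) $K_t(x,x)\ge c\,t^{-\alpha/2}$. Assume moreover that, for some $A\ge2$, the quantities $\epsilon_L=\sup_{\ell_j,\ell_k\le L}\inf_{P\in\Pi_{AL}}\|\phi_j\phi_k-P\|_{L^\infty(\mu)}$ satisfy $L^{\gamma}\epsilon_L\to0$ as $L\to\infty$ for every $\gamma>0$. Let $1\le p\le\infty$, $1/p+1/p'=1$, $\beta>\alpha/p'$, and let $S>\alpha$ be an integer. Let $b:\mathbb R\to\mathbb R$ be a mask of type $\beta$: $b$ is even and $S$ times continuously differentiable, and $b(t)=(1+t)^{-\beta}F(\log t)$ for $t>0$, where the derivatives of $F:\mathbb R\to\mathbb R$ of orders $0,\dots,S$ are bounded and $F$ is bounded below by a positive constant. Let $G:\mathbb X\times\mathbb X\to\mathbb R$ be a kernel with the formal expansion $G(x,y)=\sum_jb(\ell_j)\phi_j(x)\phi_j(y)$, that is, for every $y\in\mathbb X$, $G(\cdot,y)\in L^1(\mu)$ and $\int G(x,y)\phi_k(x)\,d\mu(x)=b(\ell_k)\phi_k(y)$ for all $k\ge 0$. Theorem. There is a constant $c>0$,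 independent of $\mathcal C$ and $\mathbf a$, such that for every finite set $\mathcal C\subset\mathbb X$ with at least two points, with minimal separation $q(\mathcal C)=\min_{x,y\in\mathcal C,\,x\ne y}\rho(x,y)$, and all real coefficients $\mathbf a=(a_y)_{y\in\mathcal C}$, $$\|\mathbf a\|_{\ell^p}\le c\,q(\mathcal C)^{\alpha/p'-\beta}\,\Big\|\sum_{y\in\mathcal C}a_yG(\cdot,y)\Big\|_{L^p(\mu)}.$$ -/

import Mathlib

open MeasureTheory Filter Set Bundle
open scoped ENNReal Topology Manifold ContDiff Bundle

namespace Eignet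

noncomputable section

/-- `φ` is an orthonormal system in `L²(μ)` of continuous real functions with `φ₀ = 1`, and `ℓ` is
a nondecreasing sequence with `ℓ₀ = 0` and `ℓⱼ → ∞`. -/
structure IsDiffusionSystem {M : Type*} [TopologicalSpace M] [MeasurableSpace M]
    (μ : Measure M) (φ : ℕ → M → ℝ) (ℓ : ℕ → ℝ) : Prop where
  continuous : ∀ j, Continuous (φ j)
  orthonormal : ∀ i j, ∫ x, φ i x * φ j x ∂μ = if i = j then 1 else 0
  phi_zero : ∀ x, φ 0 x = 1
  monotone : Monotone ℓ
  ell_zero : ℓ 0 = 0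
  tendsto : Tendsto ℓ atTop atTop

/-- The ball condition `μ(B(x, r)) ≤ c r ^ α` for all closed balls of radius `r > 0`. -/
def BallUpperBound {M : Type*} [MetricSpace M] [MeasurableSpace M]
    (μ : Measure M) (α : ℝ) : Prop :=
  ∃ c : ℝ, 0 < c ∧ ∀ (x : M) (r : ℝ), 0 < r → μ.real (Metric.closedBall x r) ≤ c * r ^ α

/-- The heat kernel `K_t(x, y) = ∑ⱼ exp(-ℓⱼ² t) φⱼ(x) φⱼ(y)`. -/
def heatKernel {M : Type*} (φ : ℕ → M → ℝ) (ℓ : ℕ → ℝ) (t : ℝ) (x y : M) : ℝ :=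
  ∑' j, Real.exp (-(ℓ j) ^ 2 * t) * (φ j x * φ j y)

/-- For `0 < t ≤ 1` the heat kernel series converges, and the kernel satisfies the Gaussian
upper bound `|K_t(x, y)| ≤ c₁ t ^ (-α / 2) exp(-c ρ(x, y)² / t)`. -/
def HeatUpperBound {M : Type*} [MetricSpace M]
    (φ : ℕ → M → ℝ) (ℓ : ℕ → ℝ) (α : ℝ) : Prop :=
  ∃ c c₁ : ℝ, 0 < c ∧ 0 < c₁ ∧ ∀ t ∈ Ioc (0 : ℝ) 1, ∀ x y : M,
    Summable (fun j => Real.exp (-(ℓ j) ^ 2 * t) * (φ j x * φ j y)) ∧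
    |heatKernel φ ℓ t x y| ≤ c₁ * t ^ (-α / 2) * Real.exp (-c * dist x y ^ 2 / t)

/-- The heat kernel has total mass one. -/
def HeatMassOne {M : Type*} [MeasurableSpace M]
    (μ : Measure M) (φ : ℕ → M → ℝ) (ℓ : ℕ → ℝ) : Prop :=
  ∀ t ∈ Ioc (0 : ℝ) 1, ∀ x : M, ∫ y, heatKernel φ ℓ t x y ∂μ = 1

/-- The gradient bound: `K_t(x, ·)` is differentiable, and at each point `y` its derivative in
the direction `v` is at most `c₁ t ^ (-α / 2 - 1) exp(-c ρ(x, y)² / t) ‖v‖`, with the Riemannian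
norm of `v`. (The coordinate vectors at `y` of the normal coordinate systems centred
at `y` are the orthonormal bases of the tangent space at `y`.) -/
def HeatGradientBound {d : ℕ} {M : Type*} [MetricSpace M]
    [ChartedSpace (EuclideanSpace ℝ (Fin d)) M]
    [RiemannianBundle (fun x : M => TangentSpace (𝓡 d) x)]
    (φ : ℕ → M → ℝ) (ℓ : ℕ → ℝ) (α : ℝ) : Prop :=
  ∃ c c₁ : ℝ, 0 < c ∧ 0 < c₁ ∧ ∀ t ∈ Ioc (0 : ℝ) 1, ∀ x y : M,
    ∃ D : TangentSpace (𝓡 d) y →L[ℝ] ℝ,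
      HasMFDerivAt (𝓡 d) 𝓘(ℝ, ℝ) (fun z => heatKernel φ ℓ t x z) y D ∧
      ∀ v : TangentSpace (𝓡 d) y,
        |D v| ≤ c₁ * t ^ (-α / 2 - 1) * Real.exp (-c * dist x y ^ 2 / t) * ‖v‖

/-- The on-diagonal lower bound `K_t(x, x) ≥ c t ^ (-α / 2)` for `0 < t ≤ 1`. -/
def HeatLowerBound {M : Type*} (φ : ℕ → M → ℝ) (ℓ : ℕ → ℝ) (α : ℝ) : Prop :=
  ∃ c : ℝ, 0 < c ∧ ∀ t ∈ Ioc (0 : ℝ) 1, ∀ x : M, c * t ^ (-α / 2) ≤ heatKernel φ ℓ t x x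

/-- The space `Π_L` of diffusion polynomials of degree at most `L`: the span of the `φⱼ` with
`ℓⱼ ≤ L`. -/
def diffusionPoly {M : Type*} (φ : ℕ → M → ℝ) (ℓ : ℕ → ℝ) (L : ℝ) : Submodule ℝ (M → ℝ) :=
  Submodule.span ℝ {f | ∃ j, ℓ j ≤ L ∧ f = φ j}

/-- `ε_L`, the supremum over `ℓⱼ, ℓₖ ≤ L` of the `L^∞(μ)` distance of `φⱼ φₖ` to `Π_{A L}`. -/
def productDefect {M : Type*} [MeasurableSpace M]
    (μ : Measure M) (φ : ℕ → M → ℝ) (ℓ : ℕ → ℝ) (A L : ℝ) : ℝ≥0∞ :=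
  ⨆ (j : ℕ) (k : ℕ) (_ : ℓ j ≤ L) (_ : ℓ k ≤ L),
    ⨅ P ∈ diffusionPoly φ ℓ (A * L), eLpNorm (fun x => φ j x * φ k x - P x) ∞ μ

/-- The product assumption: for some `A ≥ 2`, `L ^ c ε_L → 0` as `L → ∞` for every `c > 0`. -/
def ProductAssumption {M : Type*} [MeasurableSpace M]
    (μ : Measure M) (φ : ℕ → M → ℝ) (ℓ : ℕ → ℝ) : Prop :=
  ∃ A : ℝ, 2 ≤ A ∧ ∀ c : ℝ, 0 < c →
    Tendsto (fun L : ℝ => ENNReal.ofReal (L ^ c) * productDefect μ φ ℓ A L) atTop (𝓝 0)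

/-- `b` is a mask of type `β` (with smoothness `S`): an even `C^S` function with
`b(t) = (1 + t) ^ (-β) F(log t)` for `t > 0`, where the derivatives of `F` up to order `S` are
bounded and `F` is bounded below by a positive constant. (`F` is `C^S` because `b` is.) -/
def IsMask (S : ℕ) (β : ℝ) (b : ℝ → ℝ) : Prop :=
  (∀ t, b (-t) = b t) ∧ ContDiff ℝ S b ∧
  ∃ F : ℝ → ℝ, (∀ t, 0 < t → b t = (1 + t) ^ (-β) * F (Real.log t)) ∧
    (∃ C : ℝ, ∀ k ≤ S, ∀ t, |iteratedDeriv k F t| ≤ C) ∧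
    ∃ c : ℝ, 0 < c ∧ ∀ t, c ≤ F t

/-- `G` has the formal expansion `G(x, y) = ∑ⱼ b(ℓⱼ) φⱼ(x) φⱼ(y)`: for every `y`, the function
`G(·, y)` is integrable with generalized Fourier coefficients `b(ℓₖ) φₖ(y)`. -/
def HasEigExpansion {M : Type*} [MeasurableSpace M]
    (μ : Measure M) (φ : ℕ → M → ℝ) (ℓ : ℕ → ℝ) (b : ℝ → ℝ) (G : M → M → ℝ) : Prop :=
  ∀ y : M, Integrable (fun x => G x y) μ ∧
    ∀ k, ∫ x, G x y * φ k x ∂μ = b (ℓ k) * φ k y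

/-- The eignet `∑_{y ∈ C} a_y G(·, y)` with centers `C`, coefficients `a` and kernel `G`. -/
def eignet {M : Type*} (G : M → M → ℝ) (C : Finset M) (a : C → ℝ) (x : M) : ℝ :=
  ∑ y : C, a y * G x y

end

end Eignet

/-!
The inequality is proved by applying to an eignet `g = ∑ a_y G(·, y)` an operator that turns it
into a diagonally dominant matrix acting on the coefficients. All kernels involved are combinations
of heat kernels, and their decay comes from the Gaussian bounds.

Fix a scale `L` and write `X = exp(-(ℓ / L)²)`, so that the powers `X ^ k` are the multipliers of
the heat semigroup at the times `k / L²`. The multiplier `X ^ (N + 2) (1 - X) ^ N` is a finite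
combination of such powers, so its kernel decays exponentially at scale `1 / L`, and Schur's test
(`eLpNorm_count_le_of_schur`) shows that the operator followed by sampling on a `q`-separated set
with `L q` large has norm `O(L ^ (α / p))` from `L^p(μ)` to `ℓ^p`
(`IsGaussianSystem.exists_sampling_bound`). Applied to `g` it gives `∑ a_y W(x, y)`, where `W` has
the multiplier `X ^ (N + 2) (1 - X) ^ N b(ℓ)`. It remains to see that the matrix `W(x, y)` is
bounded below on `ℓ^p` by a multiple of `L ^ (α - β)` when `L = K / q` with `K` large; the two
bounds together give the power `L ^ (α / p - α + β) = L ^ (β - α / p')`.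

The diagonal is of order `L ^ (α - β)` by comparison of the heat kernel at two times of order
`L⁻²` (`IsGaussianSystem.exists_diag_lower`). Off the diagonal the smoothness of the mask enters.
The factor `(X (1 - X)) ^ N` removes the singular behaviour of the mask at low and at high
frequencies, so the multiplier of `W` is `L ^ (-β) X² f(X)` where `f` extends to a function on the
line with `S` bounded derivatives, uniformly in `L` (`IsMask.exists_profile`). Expand
`f((1 + cos θ) / 2)` into a cosine series, that is, `f` into Chebyshev polynomials of `2 X - 1`.
By Bessel's inequality the coefficients are summable with weight `(1 + |n|) ^ σ` for
`σ < S - 1 / 2` (`Tame.exists_cos_expansion`). The Chebyshev polynomial of degree `n` has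
coefficients of size at most `7 ^ n` and uses only heat kernels up to time `(n + 1) / L²`;
hence its kernel is negligible beyond distance of order `n / L`, and by the Cauchy–Schwarz
inequality its `L¹` norm with weight `(1 + L ρ) ^ δ` is `O((1 + n) ^ (α / 2 + δ))`
(`IsGaussianSystem.exists_cos_moment`). Since `S > α` and `S ≥ 1`, some `δ > 0` satisfies
`α / 2 + δ < S - 1 / 2`, and summation shows that the kernel of `X f(X)` is localized at scale
`1 / L` in `L¹`. One further heat kernel factor turns this into smallness of the off-diagonal row
sums of `W` (`IsGaussianSystem.exists_off_diagonal_le`).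
-/

/-! ### Kernels of spectral multipliers -/

namespace Eignet

/-- The kernel `∑ⱼ mⱼ φⱼ(x) φⱼ(y)` of the spectral multiplier `m`. -/
noncomputable def multKernel {M : Type*} (φ : ℕ → M → ℝ) (m : ℕ → ℝ) (x y : M) : ℝ :=
  ∑' j, m j * (φ j x * φ j y)

/-- The nonnegative weight `Q` has a kernel that is bounded by `B` on the diagonal. A multiplier
dominated by such a weight has an absolutely convergent kernel. -/
structure IsSpectralWeight {M : Type*} (φ : ℕ → M → ℝ) (Q : ℕ → ℝ) (B : ℝ) : Prop where
  nonneg : ∀ j, 0 ≤ Q j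
  summable : ∀ x, Summable fun j => Q j * (φ j x * φ j x)
  le : ∀ x, multKernel φ Q x x ≤ B

section Algebra

variable {M : Type*} {φ : ℕ → M → ℝ} {Q : ℕ → ℝ} {B : ℝ} {m m₁ m₂ : ℕ → ℝ} {D D₁ D₂ : ℝ}

lemma multKernel_comm (m : ℕ → ℝ) (x y : M) : multKernel φ m x y = multKernel φ m y x := by
  simp only [multKernel, mul_comm]

lemma abs_mult_term_le (hm : ∀ j, |m j| ≤ D * Q j)
    (x y : M) (j : ℕ) :
    |m j * (φ j x * φ j y)| ≤
      D / 2 * (Q j * (φ j x * φ j x)) + D / 2 * (Q j * (φ j y * φ j y)) := by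
  have h : |φ j x * φ j y| ≤ (φ j x * φ j x + φ j y * φ j y) / 2 := by
    rw [abs_le]
    constructor <;> nlinarith [sq_nonneg (φ j x + φ j y), sq_nonneg (φ j x - φ j y)]
  rw [abs_mul]
  calc |m j| * |φ j x * φ j y| ≤ (D * Q j) * ((φ j x * φ j x + φ j y * φ j y) / 2) :=
        mul_le_mul (hm j) h (abs_nonneg _) ((abs_nonneg _).trans (hm j))
    _ = _ := by ring

lemma IsSpectralWeight.summable_abs (hQ : IsSpectralWeight φ Q B) (hm : ∀ j, |m j| ≤ D * Q j)
    (x y : M) : Summable fun j => |m j * (φ j x * φ j y)| :=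
  Summable.of_nonneg_of_le (fun _ => abs_nonneg _) (abs_mult_term_le hm x y)
    (((hQ.summable x).mul_left _).add ((hQ.summable y).mul_left _))

lemma IsSpectralWeight.summable_mult (hQ : IsSpectralWeight φ Q B) (hm : ∀ j, |m j| ≤ D * Q j)
    (x y : M) : Summable fun j => m j * (φ j x * φ j y) :=
  (hQ.summable_abs hm x y).of_abs

lemma IsSpectralWeight.tsum_abs_le (hQ : IsSpectralWeight φ Q B) (hm : ∀ j, |m j| ≤ D * Q j)
    (hD : 0 ≤ D) (x y : M) : ∑' j, |m j * (φ j x * φ j y)| ≤ D * B := by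
  have h := (hQ.summable_abs hm x y).tsum_le_tsum (abs_mult_term_le hm x y)
    (((hQ.summable x).mul_left _).add ((hQ.summable y).mul_left _))
  rw [((hQ.summable x).mul_left _).tsum_add ((hQ.summable y).mul_left _), tsum_mul_left,
    tsum_mul_left] at h
  have hx := hQ.le x
  have hy := hQ.le y
  unfold multKernel at hx hy
  nlinarith

lemma IsSpectralWeight.abs_multKernel_le (hQ : IsSpectralWeight φ Q B)
    (hm : ∀ j, |m j| ≤ D * Q j) (hD : 0 ≤ D) (x y : M) : |multKernel φ m x y| ≤ D * B := by
  refine le_trans ?_ (hQ.tsum_abs_le hm hD x y)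
  simpa [multKernel] using norm_tsum_le_tsum_norm (f := fun j => m j * (φ j x * φ j y))
    (by simpa only [Real.norm_eq_abs] using hQ.summable_abs hm x y)

lemma IsSpectralWeight.multKernel_add (hQ : IsSpectralWeight φ Q B)
    (h₁ : ∀ j, |m₁ j| ≤ D₁ * Q j) (h₂ : ∀ j, |m₂ j| ≤ D₂ * Q j) (a b : ℝ) (x y : M) :
    multKernel φ (fun j => a * m₁ j + b * m₂ j) x y =
      a * multKernel φ m₁ x y + b * multKernel φ m₂ x y := by
  simp only [multKernel]
  rw [← tsum_mul_left, ← tsum_mul_left, ← ((hQ.summable_mult h₁ x y).mul_left a).tsum_add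
    ((hQ.summable_mult h₂ x y).mul_left b)]
  exact tsum_congr fun j => by ring

lemma multKernel_const_mul (a : ℝ) (m : ℕ → ℝ) (x y : M) :
    multKernel φ (fun j => a * m j) x y = a * multKernel φ m x y := by
  simp only [multKernel, mul_assoc, tsum_mul_left]

lemma IsSpectralWeight.multKernel_self_mono (hQ : IsSpectralWeight φ Q B)
    (h₁ : ∀ j, |m₁ j| ≤ D₁ * Q j) (h₂ : ∀ j, |m₂ j| ≤ D₂ * Q j) (h : ∀ j, m₁ j ≤ m₂ j) (x : M) :
    multKernel φ m₁ x x ≤ multKernel φ m₂ x x :=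
  (hQ.summable_mult h₁ x x).tsum_le_tsum
    (fun j => mul_le_mul_of_nonneg_right (h j) (mul_self_nonneg _)) (hQ.summable_mult h₂ x x)

end Algebra

section Integral

variable {M : Type*} [TopologicalSpace M] [MeasurableSpace M] [BorelSpace M]
  {μ : Measure M} {φ : ℕ → M → ℝ} {Q : ℕ → ℝ} {B : ℝ}
  {m m₁ m₂ : ℕ → ℝ} {D D₁ D₂ : ℝ}

lemma measurable_multKernel (hφ : ∀ j, Continuous (φ j)) (m : ℕ → ℝ) (x : M) :
    Measurable (multKernel φ m x) := by
  unfold multKernel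
  exact Measurable.tsum fun j => ((hφ j).measurable.const_mul _).const_mul _

/-- The operator with kernel `multKernel φ m` acts on an integrable function by multiplying its
Fourier coefficients by `m`. -/
lemma IsSpectralWeight.hasSum_integral (hQ : IsSpectralWeight φ Q B)
    (hφ : ∀ j, Continuous (φ j)) (hm : ∀ j, |m j| ≤ D * Q j) (hD : 0 ≤ D)
    {g : M → ℝ} (hg : Integrable g μ) (x : M) :
    HasSum (fun j => m j * φ j x * ∫ z, g z * φ j z ∂μ) (∫ z, multKernel φ m x z * g z ∂μ) := by
  have key := hasSum_integral_of_dominated_convergence (μ := μ)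
    (F := fun j z => m j * (φ j x * φ j z) * g z) (f := fun z => multKernel φ m x z * g z)
    (fun j z => |m j * (φ j x * φ j z)| * |g z|) ?_ ?_ ?_ ?_ ?_
  · have e : (fun j => m j * φ j x * ∫ z, g z * φ j z ∂μ) =
        fun j => ∫ z, m j * (φ j x * φ j z) * g z ∂μ := by
      funext j
      rw [← integral_const_mul]
      exact integral_congr_ae (ae_of_all _ fun z => by ring)
    rw [e]
    exact key
  · intro j
    exact ((((hφ j).measurable.const_mul _).const_mul _).aestronglyMeasurable).mul hg.1
  · intro j
    exact ae_of_all _ fun z => by rw [Real.norm_eq_abs, abs_mul]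
  · exact ae_of_all _ fun z => (hQ.summable_abs hm x z).mul_right _
  · simp only [tsum_mul_right]
    refine (hg.norm.const_mul (D * B)).mono' ?_ (ae_of_all _ fun z => ?_)
    · refine AEStronglyMeasurable.mul ?_ hg.norm.1
      refine (Measurable.tsum fun j => ?_).aestronglyMeasurable
      exact (((hφ j).measurable.const_mul _).const_mul _).abs
    · rw [norm_mul, Real.norm_of_nonneg (tsum_nonneg fun j => abs_nonneg _),
        Real.norm_of_nonneg (abs_nonneg _)]
      exact mul_le_mul_of_nonneg_right (hQ.tsum_abs_le hm hD x z) (abs_nonneg _)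
  · exact ae_of_all _ fun z => (hQ.summable_mult hm x z).hasSum.mul_right _

lemma integrable_of_continuous [CompactSpace M] [IsFiniteMeasure μ] {f : M → ℝ}
    (hf : Continuous f) : Integrable f μ :=
  hf.integrable_of_hasCompactSupport (HasCompactSupport.of_compactSpace f)

lemma IsSpectralWeight.integrable_multKernel [IsFiniteMeasure μ] (hQ : IsSpectralWeight φ Q B)
    (hφ : ∀ j, Continuous (φ j)) (hm : ∀ j, |m j| ≤ D * Q j) (hD : 0 ≤ D) (x : M) :
    Integrable (multKernel φ m x) μ := by
  exact Integrable.of_bound (measurable_multKernel hφ m x).aestronglyMeasurable (D * B)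
    (ae_of_all _ fun z => hQ.abs_multKernel_le hm hD x z)

/-- Composition of operators corresponds to the product of multipliers. -/
lemma IsSpectralWeight.integral_multKernel_mul [CompactSpace M] [IsFiniteMeasure μ]
    (hQ : IsSpectralWeight φ Q B)
    (hφ : ∀ j, Continuous (φ j))
    (horth : ∀ i j, ∫ x, φ i x * φ j x ∂μ = if i = j then 1 else 0)
    (h₁ : ∀ j, |m₁ j| ≤ D₁ * Q j) (hD₁ : 0 ≤ D₁) (h₂ : ∀ j, |m₂ j| ≤ D₂ * Q j) (hD₂ : 0 ≤ D₂)
    (x y : M) :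
    ∫ z, multKernel φ m₁ x z * multKernel φ m₂ z y ∂μ =
      multKernel φ (fun j => m₁ j * m₂ j) x y := by
  have coeff : ∀ k, ∫ z, multKernel φ m₂ y z * φ k z ∂μ = m₂ k * φ k y := by
    intro k
    have h := hQ.hasSum_integral hφ h₂ hD₂ (integrable_of_continuous (μ := μ) (hφ k)) y
    simp only [horth] at h
    refine h.unique ?_
    have e : (fun j => m₂ j * φ j y * if k = j then (1 : ℝ) else 0) =
        fun j => if j = k then m₂ k * φ k y else 0 := by
      funext j
      by_cases hj : j = k
      · simp [hj]
      · simp [hj, Ne.symm hj]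
    rw [e]
    exact hasSum_ite_eq k _
  have h := hQ.hasSum_integral hφ h₁ hD₁ (hQ.integrable_multKernel (μ := μ) hφ h₂ hD₂ y) x
  simp only [coeff] at h
  simp only [multKernel_comm (φ := φ) m₂ _ y]
  rw [← h.tsum_eq, multKernel]
  exact tsum_congr fun j => by ring

end Integral

end Eignet

/-! ### Exponential sums and integrals on a space with Gaussian heat kernel -/

namespace Eignet

/-- An orthonormal system of continuous functions whose heat kernel has mass one and obeys two-sided
bounds for times in `(0, 1]`, with explicit constants:
`c₀` for the measure of balls, `κ` and `γ` for the Gaussian upper bound, and `c₁` for the lower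
bound on the diagonal. -/
structure IsGaussianSystem {M : Type*} [MetricSpace M] [MeasurableSpace M] (μ : Measure M)
    (φ : ℕ → M → ℝ) (ℓ : ℕ → ℝ) (α c₀ κ γ c₁ : ℝ) : Prop where
  alpha_pos : 0 < α
  ball_pos : 0 < c₀
  kappa_pos : 0 < κ
  gamma_pos : 0 < γ
  low_pos : 0 < c₁
  continuous : ∀ j, Continuous (φ j)
  orthonormal : ∀ i j, ∫ x, φ i x * φ j x ∂μ = if i = j then 1 else 0
  ell_nonneg : ∀ j, 0 ≤ ℓ j
  ball : ∀ (x : M) (r : ℝ), 0 < r → μ.real (Metric.closedBall x r) ≤ c₀ * r ^ α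
  summable : ∀ t ∈ Ioc (0 : ℝ) 1, ∀ x y : M,
    Summable fun j => Real.exp (-(ℓ j) ^ 2 * t) * (φ j x * φ j y)
  upper : ∀ t ∈ Ioc (0 : ℝ) 1, ∀ x y : M,
    |heatKernel φ ℓ t x y| ≤ κ * t ^ (-α / 2) * Real.exp (-γ * dist x y ^ 2 / t)
  mass : ∀ t ∈ Ioc (0 : ℝ) 1, ∀ x : M, ∫ y, heatKernel φ ℓ t x y ∂μ = 1
  lower : ∀ t ∈ Ioc (0 : ℝ) 1, ∀ x : M, c₁ * t ^ (-α / 2) ≤ heatKernel φ ℓ t x x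

/-- The spectral multiplier `exp(-(ℓⱼ / L)²)` of the heat semigroup at time `L⁻²`. -/
noncomputable def gaussMult (ℓ : ℕ → ℝ) (L : ℝ) (j : ℕ) : ℝ := Real.exp (-(ℓ j / L) ^ 2)

lemma gaussMult_pos (ℓ : ℕ → ℝ) (L : ℝ) (j : ℕ) : 0 < gaussMult ℓ L j := Real.exp_pos _

lemma gaussMult_le_one (ℓ : ℕ → ℝ) (L : ℝ) (j : ℕ) : gaussMult ℓ L j ≤ 1 :=
  Real.exp_le_one_iff.2 (by nlinarith [sq_nonneg (ℓ j / L)])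

lemma gaussMult_pow (ℓ : ℕ → ℝ) (L : ℝ) (k j : ℕ) :
    gaussMult ℓ L j ^ k = Real.exp (-(ℓ j) ^ 2 * (k / L ^ 2)) := by
  rw [gaussMult, ← Real.exp_nat_mul]
  congr 1
  rw [div_pow]
  ring

lemma multKernel_gaussMult_pow {M : Type*} (φ : ℕ → M → ℝ) (ℓ : ℕ → ℝ) (L : ℝ) (k : ℕ) (x y : M) :
    multKernel φ (fun j => gaussMult ℓ L j ^ k) x y = heatKernel φ ℓ (k / L ^ 2) x y := by
  simp only [multKernel, heatKernel, gaussMult_pow]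

section Basic

variable {M : Type*} [MetricSpace M] [MeasurableSpace M] {μ : Measure M}
  {φ : ℕ → M → ℝ} {ℓ : ℕ → ℝ} {α c₀ κ γ c₁ : ℝ}

lemma time_mem {L : ℝ} (hL : 0 < L) {k : ℕ} (hk : 1 ≤ k) (hkL : (k : ℝ) ≤ L ^ 2) :
    (k / L ^ 2 : ℝ) ∈ Ioc (0 : ℝ) 1 := by
  have : (1 : ℝ) ≤ k := by exact_mod_cast hk
  exact ⟨by positivity, (div_le_one (by positivity)).2 hkL⟩

lemma time_rpow {L : ℝ} (hL : 0 < L) (k : ℕ) :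
    (k / L ^ 2 : ℝ) ^ (-α / 2) = (k : ℝ) ^ (-α / 2) * L ^ α := by
  rw [Real.div_rpow (by positivity) (by positivity), ← Real.rpow_natCast, ← Real.rpow_mul hL.le,
    div_eq_mul_inv, ← Real.rpow_neg hL.le]
  congr 2
  push_cast
  ring

namespace IsGaussianSystem

variable (h : IsGaussianSystem μ φ ℓ α c₀ κ γ c₁)
include h

lemma abs_gauss_pow_le {L : ℝ} (hL : 0 < L) {k : ℕ} (hk : 1 ≤ k) (hkL : (k : ℝ) ≤ L ^ 2)
    (x y : M) :
    |multKernel φ (fun j => gaussMult ℓ L j ^ k) x y| ≤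
      κ * L ^ α * Real.exp (-(γ * (L * dist x y) ^ 2 / k)) := by
  have hk1 : (1 : ℝ) ≤ k := by exact_mod_cast hk
  have hα := h.alpha_pos
  have hκ := h.kappa_pos
  rw [multKernel_gaussMult_pow]
  refine (h.upper _ (time_mem hL hk hkL) x y).trans ?_
  rw [time_rpow hL]
  have e : -γ * dist x y ^ 2 / (k / L ^ 2) = -(γ * (L * dist x y) ^ 2 / k) := by
    field_simp
  rw [e]
  have h1 : (k : ℝ) ^ (-α / 2) ≤ 1 := Real.rpow_le_one_of_one_le_of_nonpos hk1 (by linarith)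
  have hLα : 0 < L ^ α := by positivity
  gcongr
  nlinarith

lemma gauss_pow_self_le {L : ℝ} (hL : 0 < L) {k : ℕ} (hk : 1 ≤ k) (hkL : (k : ℝ) ≤ L ^ 2)
    (x : M) :
    multKernel φ (fun j => gaussMult ℓ L j ^ k) x x ≤ κ * ((k : ℝ) ^ (-α / 2) * L ^ α) := by
  rw [multKernel_gaussMult_pow]
  have := (le_abs_self _).trans (h.upper _ (time_mem hL hk hkL) x x)
  rw [time_rpow hL] at this
  simpa using this

lemma le_gauss_pow_self {L : ℝ} (hL : 0 < L) {k : ℕ} (hk : 1 ≤ k) (hkL : (k : ℝ) ≤ L ^ 2)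
    (x : M) :
    c₁ * ((k : ℝ) ^ (-α / 2) * L ^ α) ≤ multKernel φ (fun j => gaussMult ℓ L j ^ k) x x := by
  rw [multKernel_gaussMult_pow, ← time_rpow hL]
  exact h.lower _ (time_mem hL hk hkL) x

lemma isSpectralWeight {L : ℝ} (hL : 1 ≤ L) :
    IsSpectralWeight φ (gaussMult ℓ L) (κ * L ^ α) where
  nonneg j := (gaussMult_pos ℓ L j).le
  summable x := by
    have h1 := h.summable _ (time_mem (by linarith : 0 < L) le_rfl
      (by simpa using one_le_pow₀ hL (n := 2) : ((1 : ℕ) : ℝ) ≤ L ^ 2)) x x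
    simpa only [← gaussMult_pow, pow_one] using h1
  le x := by
    have h1 := h.gauss_pow_self_le (by linarith : 0 < L) le_rfl
      (by simpa using one_le_pow₀ hL (n := 2) : ((1 : ℕ) : ℝ) ≤ L ^ 2) x
    simpa using h1

end IsGaussianSystem

lemma exp_neg_sq_le {g s a : ℝ} (hg : 0 < g) :
    Real.exp (-(g * s ^ 2)) ≤ Real.exp (a ^ 2 / (4 * g)) * Real.exp (-(a * s)) := by
  rw [← Real.exp_add, Real.exp_le_exp]
  have : 0 ≤ (2 * g * s - a) ^ 2 / (4 * g) := by positivity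
  have e : (2 * g * s - a) ^ 2 / (4 * g) = g * s ^ 2 - a * s + a ^ 2 / (4 * g) := by
    field_simp
    ring
  linarith

end Basic

section Geometry

variable {M : Type*} [MetricSpace M] [MeasurableSpace M] [BorelSpace M] {μ : Measure M}
  [IsProbabilityMeasure μ] {φ : ℕ → M → ℝ} {ℓ : ℕ → ℝ} {α c₀ κ γ c₁ : ℝ}

lemma summable_exp_mul_rpow (α : ℝ) :
    Summable fun k : ℕ => Real.exp (-k) * ((k : ℝ) + 1) ^ α := by
  obtain ⟨n, hn⟩ := exists_nat_ge α
  have h1 := (summable_nat_add_iff 1).2 (Real.summable_pow_mul_exp_neg_nat_mul n one_pos)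
  refine Summable.of_nonneg_of_le (fun k => by positivity) (fun k => ?_) (h1.mul_left (Real.exp 1))
  have h2 : ((k : ℝ) + 1) ^ α ≤ ((k : ℝ) + 1) ^ n := by
    rw [← Real.rpow_natCast]
    exact Real.rpow_le_rpow_of_exponent_le (by linarith [(Nat.cast_nonneg k : (0 : ℝ) ≤ k)]) hn
  have h3 : Real.exp 1 * ((((k + 1 : ℕ) : ℝ)) ^ n * Real.exp (-1 * ((k + 1 : ℕ) : ℝ))) =
      Real.exp (-k) * ((k : ℝ) + 1) ^ n := by
    push_cast
    have : Real.exp (-k) = Real.exp 1 * Real.exp (-1 * ((k : ℝ) + 1)) := by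
      rw [← Real.exp_add]
      congr 1
      ring
    rw [this]
    ring
  rw [h3]
  gcongr

namespace IsGaussianSystem

variable (h : IsGaussianSystem μ φ ℓ α c₀ κ γ c₁)
include h

/-- At scale `1 / L`, an exponentially decaying profile has integral of order `L ^ (-α)`: the
profile is dominated by a sum of indicators of the balls of radius `(k + 1) / L` weighted by
`exp(-k)`. -/
lemma exists_lintegral_exp_le :
    ∃ C : ℝ, 0 < C ∧ ∀ L : ℝ, 0 < L → ∀ x : M,
      ∫⁻ z, ENNReal.ofReal (Real.exp (-(L * dist x z))) ∂μ ≤ ENNReal.ofReal (C * L ^ (-α)) := by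
  set s := ∑' k : ℕ, Real.exp (-k) * ((k : ℝ) + 1) ^ α with hs
  have hsum := summable_exp_mul_rpow α
  have hc := h.ball_pos
  have hspos : 0 < s := hsum.tsum_pos (fun k => by positivity) 0 (by positivity)
  refine ⟨c₀ * s, by positivity, fun L hL x => ?_⟩
  have hpt : ∀ z, ENNReal.ofReal (Real.exp (-(L * dist x z))) ≤
      ∑' k : ℕ, (Metric.closedBall x (((k : ℝ) + 1) / L)).indicator
        (fun _ => ENNReal.ofReal (Real.exp (-k))) z := by
    intro z
    have hd : 0 ≤ L * dist x z := by positivity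
    refine le_trans ?_ (ENNReal.le_tsum ⌊L * dist x z⌋₊)
    rw [indicator_of_mem]
    · exact ENNReal.ofReal_le_ofReal (Real.exp_le_exp.2 (neg_le_neg (Nat.floor_le hd)))
    · rw [Metric.mem_closedBall, dist_comm, le_div_iff₀ hL, mul_comm]
      exact (Nat.lt_floor_add_one _).le
  calc ∫⁻ z, ENNReal.ofReal (Real.exp (-(L * dist x z))) ∂μ
      ≤ ∫⁻ z, ∑' k : ℕ, (Metric.closedBall x (((k : ℝ) + 1) / L)).indicator
        (fun _ => ENNReal.ofReal (Real.exp (-k))) z ∂μ := lintegral_mono hpt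
    _ = ∑' k : ℕ, ENNReal.ofReal (Real.exp (-k)) *
          μ (Metric.closedBall x (((k : ℝ) + 1) / L)) := by
        rw [lintegral_tsum fun k =>
          (measurable_const.indicator Metric.isClosed_closedBall.measurableSet).aemeasurable]
        exact tsum_congr fun k =>
          lintegral_indicator_const Metric.isClosed_closedBall.measurableSet _
    _ ≤ ∑' k : ℕ, ENNReal.ofReal (c₀ * L ^ (-α) * (Real.exp (-k) * ((k : ℝ) + 1) ^ α)) := by
        refine ENNReal.tsum_le_tsum fun k => ?_
        have hk := h.ball x (((k : ℝ) + 1) / L) (by positivity)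
        have hμ : μ (Metric.closedBall x (((k : ℝ) + 1) / L)) ≤
            ENNReal.ofReal (c₀ * (((k : ℝ) + 1) / L) ^ α) :=
          (ENNReal.le_ofReal_iff_toReal_le (measure_ne_top _ _) (by positivity)).2 hk
        refine (mul_le_mul_right hμ _).trans (le_of_eq ?_)
        rw [← ENNReal.ofReal_mul (by positivity), Real.div_rpow (by positivity) hL.le,
          Real.rpow_neg hL.le]
        congr 1
        field_simp
    _ = ENNReal.ofReal (c₀ * s * L ^ (-α)) := by
        rw [← ENNReal.ofReal_tsum_of_nonneg (fun k => by positivity) (hsum.mul_left _),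
          tsum_mul_left, ← hs]
        congr 1
        ring

/-- Balls of radius comparable to `1 / L` have measure at least of order `L ^ (-α)`, because the
heat kernel at time `L⁻²` has mass one and almost all of it lies in such a ball. -/
lemma exists_ball_lower :
    ∃ R c : ℝ, 0 < R ∧ 0 < c ∧ ∀ L : ℝ, 1 ≤ L → ∀ x : M,
      c * L ^ (-α) ≤ μ.real (Metric.closedBall x (R / L)) := by
  obtain ⟨C, hC, hint⟩ := h.exists_lintegral_exp_le
  have hκ := h.kappa_pos
  have hγ := h.gamma_pos
  set E := κ * Real.exp (2 ^ 2 / (4 * γ)) * C with hE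
  have hEpos : 0 < E := by positivity
  -- The radius is chosen so that the heat kernel has mass at most one half outside the ball.
  obtain ⟨R, hR⟩ : ∃ R : ℝ, 0 < R ∧ E * Real.exp (-R) ≤ 1 / 2 := by
    refine ⟨Real.log (2 * E + 1), Real.log_pos (by linarith), ?_⟩
    rw [Real.exp_neg, Real.exp_log (by positivity), ← div_eq_mul_inv, div_le_iff₀ (by positivity)]
    linarith
  refine ⟨R, 1 / (2 * κ), hR.1, by positivity, fun L hL x => ?_⟩
  have hL0 : 0 < L := by linarith
  set Bx := Metric.closedBall x (R / L) with hBx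
  have hLα : 0 < L ^ α := by positivity
  have hone : ((1 : ℕ) : ℝ) ≤ L ^ 2 := by simpa using one_le_pow₀ hL (n := 2)
  have hK : ∀ z, |heatKernel φ ℓ ((1 : ℕ) / L ^ 2) x z| ≤
      κ * L ^ α * Real.exp (-(γ * (L * dist x z) ^ 2)) := by
    intro z
    have := h.abs_gauss_pow_le hL0 le_rfl hone x z
    rw [multKernel_gaussMult_pow] at this
    simpa using this
  have hpt : ∀ z, ‖heatKernel φ ℓ ((1 : ℕ) / L ^ 2) x z‖ₑ ≤
      Bx.indicator (fun _ => ENNReal.ofReal (κ * L ^ α)) z +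
      ENNReal.ofReal (κ * L ^ α * Real.exp (2 ^ 2 / (4 * γ)) * Real.exp (-R)) *
        ENNReal.ofReal (Real.exp (-(L * dist x z))) := by
    intro z
    rw [Real.enorm_eq_ofReal_abs]
    by_cases hz : z ∈ Bx
    · rw [indicator_of_mem hz]
      refine le_add_right (ENNReal.ofReal_le_ofReal ((hK z).trans ?_))
      refine mul_le_of_le_one_right (by positivity) (Real.exp_le_one_iff.2 ?_)
      have : 0 ≤ γ * (L * dist x z) ^ 2 := by positivity
      linarith
    · rw [indicator_of_notMem hz, zero_add, ← ENNReal.ofReal_mul (by positivity)]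
      refine ENNReal.ofReal_le_ofReal ((hK z).trans ?_)
      have hz' : R ≤ L * dist x z := by
        rw [hBx, Metric.mem_closedBall, not_le, dist_comm, div_lt_iff₀ hL0] at hz
        linarith
      calc κ * L ^ α * Real.exp (-(γ * (L * dist x z) ^ 2))
          ≤ κ * L ^ α * (Real.exp (2 ^ 2 / (4 * γ)) * Real.exp (-(2 * (L * dist x z)))) := by
            gcongr
            exact exp_neg_sq_le hγ
        _ ≤ κ * L ^ α * (Real.exp (2 ^ 2 / (4 * γ)) *
              (Real.exp (-R) * Real.exp (-(L * dist x z)))) := by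
            rw [← Real.exp_add (-R)]
            gcongr
            linarith
        _ = _ := by ring
  have hlow : (1 : ℝ≥0∞) ≤ ∫⁻ z, ‖heatKernel φ ℓ ((1 : ℕ) / L ^ 2) x z‖ₑ ∂μ := by
    have h1 := enorm_integral_le_lintegral_enorm (μ := μ)
      (fun z => heatKernel φ ℓ ((1 : ℕ) / L ^ 2) x z)
    rw [h.mass _ (time_mem hL0 le_rfl hone) x] at h1
    simpa using h1
  have hup : ∫⁻ z, ‖heatKernel φ ℓ ((1 : ℕ) / L ^ 2) x z‖ₑ ∂μ ≤
      ENNReal.ofReal (κ * L ^ α * μ.real Bx + E * Real.exp (-R)) := by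
    refine (lintegral_mono hpt).trans ?_
    rw [lintegral_add_left
        (measurable_const.indicator Metric.isClosed_closedBall.measurableSet),
      lintegral_indicator_const Metric.isClosed_closedBall.measurableSet,
      lintegral_const_mul' _ _ ENNReal.ofReal_ne_top, ENNReal.ofReal_add (by positivity)
        (by positivity), ENNReal.ofReal_mul (by positivity : 0 ≤ κ * L ^ α),
      ofReal_measureReal (measure_ne_top _ _)]
    gcongr
    refine (mul_le_mul_right (hint L hL0 x) _).trans (le_of_eq ?_)
    rw [← ENNReal.ofReal_mul (by positivity), Real.rpow_neg hL0.le]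
    congr 1
    rw [hE]
    field_simp
  have hfin := hlow.trans hup
  rw [ENNReal.one_le_ofReal] at hfin
  have h2 : 1 / 2 ≤ κ * L ^ α * μ.real Bx := by linarith [hR.2]
  rw [Real.rpow_neg hL0.le]
  calc 1 / (2 * κ) * (L ^ α)⁻¹ = (1 / 2) / (κ * L ^ α) := by field_simp
    _ ≤ μ.real Bx := by
      rw [div_le_iff₀ (by positivity)]
      linarith

/-- Exponential sums over a set with separation `q` are bounded once `L q` is large. -/
lemma exists_sum_exp_le :
    ∃ C K : ℝ, 0 < C ∧ 0 < K ∧ ∀ L : ℝ, 1 ≤ L → ∀ (q : ℝ) (A : Finset M),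
      (∀ x ∈ A, ∀ y ∈ A, x ≠ y → q ≤ dist x y) → K ≤ L * q → ∀ z : M,
      ∑ y ∈ A, Real.exp (-(L * dist z y)) ≤ C := by
  obtain ⟨C, hC, hint⟩ := h.exists_lintegral_exp_le
  obtain ⟨R, c, hR, hc, hball⟩ := h.exists_ball_lower
  refine ⟨Real.exp R * C / c, 2 * R + 1, by positivity, by positivity, ?_⟩
  intro L hL q A hsep hK z
  have hL0 : 0 < L := by linarith
  have hdisj : Set.PairwiseDisjoint (A : Set M) fun y => Metric.closedBall y (R / L) := by
    intro x hx y hy hxy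
    refine Metric.closedBall_disjoint_closedBall ?_
    refine lt_of_lt_of_le ?_ (hsep x hx y hy hxy)
    rw [← add_div, div_lt_iff₀ hL0]
    linarith
  have hterm : ∀ y, ENNReal.ofReal (c * L ^ (-α) * Real.exp (-(L * dist z y))) ≤
      ∫⁻ w in Metric.closedBall y (R / L),
        ENNReal.ofReal (Real.exp R) * ENNReal.ofReal (Real.exp (-(L * dist z w))) ∂μ := by
    intro y
    have h1 : ∫⁻ w in Metric.closedBall y (R / L),
        ENNReal.ofReal (Real.exp (-(L * dist z y))) ∂μ ≤
        ∫⁻ w in Metric.closedBall y (R / L),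
          ENNReal.ofReal (Real.exp R) * ENNReal.ofReal (Real.exp (-(L * dist z w))) ∂μ := by
      refine setLIntegral_mono' Metric.isClosed_closedBall.measurableSet fun w hw => ?_
      rw [← ENNReal.ofReal_mul (by positivity), ← Real.exp_add]
      refine ENNReal.ofReal_le_ofReal (Real.exp_le_exp.2 ?_)
      have h2 : L * dist w y ≤ R := by
        have := (le_div_iff₀ hL0).1 (Metric.mem_closedBall.1 hw)
        linarith
      have h3 : L * dist z w ≤ L * (dist z y + dist w y) := by
        gcongr
        exact dist_triangle_right z w y
      linarith
    refine le_trans ?_ h1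
    rw [setLIntegral_const, mul_comm, ENNReal.ofReal_mul (by positivity)]
    gcongr
    rw [ENNReal.ofReal_le_iff_le_toReal (measure_ne_top _ _)]
    exact hball L hL y
  have hsum : ENNReal.ofReal (c * L ^ (-α) * ∑ y ∈ A, Real.exp (-(L * dist z y))) ≤
      ENNReal.ofReal (Real.exp R * (C * L ^ (-α))) := by
    rw [Finset.mul_sum, ENNReal.ofReal_sum_of_nonneg fun y _ => by positivity]
    refine (Finset.sum_le_sum fun y _ => hterm y).trans ?_
    rw [← lintegral_biUnion_finset hdisj
      fun y _ => Metric.isClosed_closedBall.measurableSet]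
    refine (setLIntegral_le_lintegral _ _).trans ?_
    rw [lintegral_const_mul' _ _ ENNReal.ofReal_ne_top, ENNReal.ofReal_mul (by positivity)]
    gcongr
    exact hint L hL0 z
  rw [ENNReal.ofReal_le_ofReal_iff (by positivity)] at hsum
  have hLα : 0 < L ^ (-α) := by positivity
  rw [le_div_iff₀ hc]
  refine le_of_mul_le_mul_left ?_ hLα
  linarith

end IsGaussianSystem

end Geometry

end Eignet

/-! ### Families of functions with controlled derivatives -/

namespace Eignet

/-- The functions `g i` and their derivatives up to order `k` exist on `s` and are bounded there by
constant multiples of powers of `w`, uniformly in `i`. -/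
def Tame {ι : Type*} (s : Set ℝ) (w : ℝ → ℝ) : ℕ → (ι → ℝ → ℝ) → Prop
  | 0, g => ∃ (C : ℝ) (m : ℕ), 0 ≤ C ∧ ∀ i, ∀ x ∈ s, |g i x| ≤ C * w x ^ m
  | k + 1, g => (∃ (C : ℝ) (m : ℕ), 0 ≤ C ∧ ∀ i, ∀ x ∈ s, |g i x| ≤ C * w x ^ m) ∧
      ∃ g' : ι → ℝ → ℝ, (∀ i, ∀ x ∈ s, HasDerivAt (g i) (g' i x) x) ∧ Tame s w k g'

namespace Tame

variable {ι : Type*} {s : Set ℝ} {w : ℝ → ℝ} {k : ℕ} {g g₁ g₂ : ι → ℝ → ℝ}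

lemma bound (h : Tame s w k g) :
    ∃ (C : ℝ) (m : ℕ), 0 ≤ C ∧ ∀ i, ∀ x ∈ s, |g i x| ≤ C * w x ^ m := by
  cases k with
  | zero => exact h
  | succ k => exact h.1

lemma of_succ (h : Tame s w (k + 1) g) : Tame s w k g := by
  induction k generalizing g with
  | zero => exact h.1
  | succ k ih =>
    obtain ⟨hb, g', hd, hg'⟩ := h
    exact ⟨hb, g', hd, ih hg'⟩

lemma zero : Tame s w k (fun (_ : ι) _ => (0 : ℝ)) := by
  have hb : ∃ (C : ℝ) (m : ℕ), 0 ≤ C ∧ ∀ _i : ι, ∀ x ∈ s, |(0 : ℝ)| ≤ C * w x ^ m :=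
    ⟨0, 0, le_rfl, fun _ _ _ => by simp⟩
  induction k with
  | zero => exact hb
  | succ k ih => exact ⟨hb, fun _ _ => 0, fun _ x _ => hasDerivAt_const x 0, ih⟩

lemma const (c : ℝ) : Tame s w k (fun (_ : ι) _ => c) := by
  have hb : ∃ (C : ℝ) (m : ℕ), 0 ≤ C ∧ ∀ _i : ι, ∀ x ∈ s, |c| ≤ C * w x ^ m :=
    ⟨|c|, 0, abs_nonneg _, fun _ _ _ => by simp⟩
  cases k with
  | zero => exact hb
  | succ k => exact ⟨hb, fun _ _ => 0, fun _ x _ => hasDerivAt_const x c, zero⟩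

lemma add_bound (hw : ∀ x ∈ s, 1 ≤ w x) (h₁ : Tame s w k g₁) (h₂ : Tame s w k g₂) :
    ∃ (C : ℝ) (m : ℕ), 0 ≤ C ∧ ∀ i, ∀ x ∈ s, |g₁ i x + g₂ i x| ≤ C * w x ^ m := by
  obtain ⟨C₁, m₁, hC₁, hb₁⟩ := h₁.bound
  obtain ⟨C₂, m₂, hC₂, hb₂⟩ := h₂.bound
  refine ⟨C₁ + C₂, max m₁ m₂, by positivity, fun i x hx => (abs_add_le _ _).trans ?_⟩
  rw [add_mul]
  refine add_le_add ((hb₁ i x hx).trans ?_) ((hb₂ i x hx).trans ?_)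
  · exact mul_le_mul_of_nonneg_left (pow_le_pow_right₀ (hw x hx) (le_max_left _ _)) hC₁
  · exact mul_le_mul_of_nonneg_left (pow_le_pow_right₀ (hw x hx) (le_max_right _ _)) hC₂

lemma add (hw : ∀ x ∈ s, 1 ≤ w x) (h₁ : Tame s w k g₁) (h₂ : Tame s w k g₂) :
    Tame s w k (fun i x => g₁ i x + g₂ i x) := by
  induction k generalizing g₁ g₂ with
  | zero => exact add_bound hw h₁ h₂
  | succ k ih =>
    have hb := add_bound hw h₁ h₂
    obtain ⟨-, g₁', hd₁, hg₁⟩ := h₁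
    obtain ⟨-, g₂', hd₂, hg₂⟩ := h₂
    exact ⟨hb, fun i x => g₁' i x + g₂' i x, fun i x hx => (hd₁ i x hx).add (hd₂ i x hx),
      ih hg₁ hg₂⟩

lemma mul_bound (h₁ : Tame s w k g₁) (h₂ : Tame s w k g₂) :
    ∃ (C : ℝ) (m : ℕ), 0 ≤ C ∧ ∀ i, ∀ x ∈ s, |g₁ i x * g₂ i x| ≤ C * w x ^ m := by
  obtain ⟨C₁, m₁, hC₁, hb₁⟩ := h₁.bound
  obtain ⟨C₂, m₂, hC₂, hb₂⟩ := h₂.bound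
  refine ⟨C₁ * C₂, m₁ + m₂, by positivity, fun i x hx => ?_⟩
  rw [abs_mul, pow_add]
  calc |g₁ i x| * |g₂ i x| ≤ (C₁ * w x ^ m₁) * (C₂ * w x ^ m₂) :=
        mul_le_mul (hb₁ i x hx) (hb₂ i x hx) (abs_nonneg _) ((abs_nonneg _).trans (hb₁ i x hx))
    _ = _ := by ring

lemma mul (hw : ∀ x ∈ s, 1 ≤ w x) (h₁ : Tame s w k g₁) (h₂ : Tame s w k g₂) :
    Tame s w k (fun i x => g₁ i x * g₂ i x) := by
  induction k generalizing g₁ g₂ with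
  | zero => exact mul_bound h₁ h₂
  | succ k ih =>
    have hb := mul_bound h₁ h₂
    have h₁' := h₁.of_succ
    have h₂' := h₂.of_succ
    obtain ⟨-, g₁', hd₁, hg₁⟩ := h₁
    obtain ⟨-, g₂', hd₂, hg₂⟩ := h₂
    exact ⟨hb, fun i x => g₁' i x * g₂ i x + g₁ i x * g₂' i x,
      fun i x hx => (hd₁ i x hx).mul (hd₂ i x hx), add hw (ih hg₁ h₂') (ih h₁' hg₂)⟩

lemma const_mul (hw : ∀ x ∈ s, 1 ≤ w x) (c : ℝ) (h : Tame s w k g) :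
    Tame s w k (fun i x => c * g i x) :=
  mul hw (const c) h

/-- Composition with an outer family whose derivatives are bounded on the line. -/
lemma comp (hw : ∀ x ∈ s, 1 ≤ w x) {f v v' : ι → ℝ → ℝ}
    (hf : Tame univ (fun _ => 1) k f) (hv : ∀ i, ∀ x ∈ s, HasDerivAt (v i) (v' i x) x)
    (hv' : Tame s w k v') : Tame s w k (fun i x => f i (v i x)) := by
  induction k generalizing f with
  | zero =>
    obtain ⟨C, m, hC, hb⟩ := hf
    exact ⟨C, 0, hC, fun i x _ => by simpa using hb i (v i x) (mem_univ _)⟩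
  | succ k ih =>
    obtain ⟨⟨C, m, hC, hb⟩, f', hd, hf'⟩ := hf
    refine ⟨⟨C, 0, hC, fun i x _ => by simpa using hb i (v i x) (mem_univ _)⟩,
      fun i x => f' i (v i x) * v' i x, fun i x hx => ?_, mul hw (ih hf' hv'.of_succ) hv'.of_succ⟩
    exact (hd i (v i x) (mem_univ _)).comp x (hv i x hx)

lemma unitWeight_pos {x : ℝ} (hx : x ∈ Ioo (0 : ℝ) 1) : 0 < x * (1 - x) :=
  mul_pos hx.1 (by linarith [hx.2])

lemma unitWeight_le_one {x : ℝ} (hx : x ∈ Ioo (0 : ℝ) 1) : x * (1 - x) ≤ 1 := by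
  nlinarith [hx.1, hx.2]

lemma one_le_inv_unitWeight {x : ℝ} (hx : x ∈ Ioo (0 : ℝ) 1) : 1 ≤ (x * (1 - x))⁻¹ :=
  (one_le_inv₀ (unitWeight_pos hx)).2 (unitWeight_le_one hx)

/-- Two spare powers of `x (1 - x)` leave a zero of order two at the endpoints. -/
lemma exists_quadratic_bound (h : Tame (Ioo 0 1) (fun x => (x * (1 - x))⁻¹) k g) :
    ∃ (C : ℝ) (m : ℕ), 0 ≤ C ∧ ∀ N, m + 2 ≤ N → ∀ i x,
      |(Ioo (0 : ℝ) 1).indicator (fun x => (x * (1 - x)) ^ N * g i x) x| ≤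
        C * (Ioo (0 : ℝ) 1).indicator (fun x => (x * (1 - x)) ^ 2) x := by
  obtain ⟨C, m, hC, hb⟩ := h.bound
  refine ⟨C, m, hC, fun N hN i x => ?_⟩
  by_cases hx : x ∈ Ioo (0 : ℝ) 1
  · have h0 := unitWeight_pos hx
    rw [indicator_of_mem hx, indicator_of_mem hx, abs_mul, abs_of_pos (pow_pos h0 N)]
    calc (x * (1 - x)) ^ N * |g i x|
        ≤ (x * (1 - x)) ^ (m + 2) * (C * ((x * (1 - x))⁻¹) ^ m) :=
          mul_le_mul (pow_le_pow_of_le_one h0.le (unitWeight_le_one hx) hN) (hb i x hx)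
            (abs_nonneg _) (by positivity)
      _ = C * (x * (1 - x)) ^ 2 := by
          rw [pow_add, inv_pow]
          field_simp
  · rw [indicator_of_notMem hx, indicator_of_notMem hx]
    simp

/-- Multiplication by a high power of `x (1 - x)` turns a family that is tame on `(0, 1)` into one
that extends by zero to the line with bounded derivatives. -/
lemma exists_extend (h : Tame (Ioo 0 1) (fun x => (x * (1 - x))⁻¹) k g) :
    ∃ N₀ : ℕ, ∀ N, N₀ ≤ N → Tame univ (fun _ => 1) k
      (fun i => (Ioo (0 : ℝ) 1).indicator fun x => (x * (1 - x)) ^ N * g i x) := by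
  have hw : ∀ x ∈ Ioo (0 : ℝ) 1, 1 ≤ (x * (1 - x))⁻¹ := fun x hx => one_le_inv_unitWeight hx
  have hone : ∀ x ∈ (univ : Set ℝ), (1 : ℝ) ≤ (fun _ => (1 : ℝ)) x := fun _ _ => le_rfl
  have hle1 : ∀ x : ℝ, (Ioo (0 : ℝ) 1).indicator (fun x => (x * (1 - x)) ^ 2) x ≤ 1 := by
    intro x
    refine indicator_apply_le' (fun hx => ?_) fun _ => zero_le_one
    exact pow_le_one₀ (unitWeight_pos hx).le (unitWeight_le_one hx)
  induction k generalizing g with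
  | zero =>
    obtain ⟨C, m, hC, hb⟩ := exists_quadratic_bound h
    refine ⟨m + 2, fun N hN => ⟨C, 0, hC, fun i x _ => (hb N hN i x).trans ?_⟩⟩
    simpa using mul_le_mul_of_nonneg_left (hle1 x) hC
  | succ k ih =>
    obtain ⟨C, m, hC, hb⟩ := exists_quadratic_bound h
    have hg := h.of_succ
    obtain ⟨-, g', hd, hg'⟩ := h
    have hlin : Tame (Ioo 0 1) (fun x => (x * (1 - x))⁻¹) k
        (fun (_ : ι) (x : ℝ) => 1 + (-2) * x) := by
      have hb2 : ∃ (C : ℝ) (m : ℕ), 0 ≤ C ∧ ∀ _i : ι, ∀ x ∈ Ioo (0 : ℝ) 1,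
          |1 + (-2) * x| ≤ C * ((x * (1 - x))⁻¹) ^ m :=
        ⟨1, 0, zero_le_one, fun _ x hx => by
          simpa using abs_le.2 ⟨by linarith [hx.2], by linarith [hx.1]⟩⟩
      cases k with
      | zero => exact hb2
      | succ k =>
        refine ⟨hb2, fun _ _ => -2, fun _ x _ => ?_, const (-2)⟩
        simpa using ((hasDerivAt_id x).const_mul (-2 : ℝ)).const_add 1
    obtain ⟨N₁, hN₁⟩ := ih hg'
    obtain ⟨N₂, hN₂⟩ := ih (mul hw hlin hg)
    refine ⟨max (m + 2) (max N₁ (N₂ + 1)), fun N hN => ?_⟩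
    have hNm : m + 2 ≤ N := (le_max_left _ _).trans hN
    have hN1 : N₁ ≤ N := ((le_max_left _ _).trans (le_max_right _ _)).trans hN
    have hN2 : N₂ ≤ N - 1 := by
      have := ((le_max_right _ _).trans (le_max_right _ _)).trans hN
      omega
    refine ⟨⟨C, 0, hC, fun i x _ => (hb N hNm i x).trans ?_⟩, _, fun i x _ => ?_,
      add hone (hN₁ N hN1) (const_mul hone (N : ℝ) (hN₂ (N - 1) hN2))⟩
    · simpa using mul_le_mul_of_nonneg_left (hle1 x) hC
    by_cases hx : x ∈ Ioo (0 : ℝ) 1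
    · rw [indicator_of_mem hx, indicator_of_mem hx]
      have hW : HasDerivAt (fun x : ℝ => x * (1 - x)) (1 + (-2) * x) x := by
        refine ((hasDerivAt_id' x).mul ((hasDerivAt_id' x).const_sub 1)).congr_deriv ?_
        ring
      have hD := (hW.fun_pow N).fun_mul (hd i x hx)
      refine (hD.congr_of_eventuallyEq ?_).congr_deriv ?_
      · filter_upwards [isOpen_Ioo.mem_nhds hx] with y hy
        rw [indicator_of_mem hy]
      · ring
    · rw [indicator_of_notMem hx, indicator_of_notMem hx, mul_zero, add_zero]
      have hO : ((Ioo (0 : ℝ) 1).indicator fun x => (x * (1 - x)) ^ N * g i x)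
          =O[𝓝 x] fun y => ‖y - x‖ ^ 2 := by
        refine Asymptotics.IsBigO.of_bound C (Eventually.of_forall fun y => ?_)
        rw [Real.norm_eq_abs, Real.norm_of_nonneg (by positivity), Real.norm_eq_abs]
        refine (hb N hNm i y).trans (mul_le_mul_of_nonneg_left ?_ hC)
        refine indicator_apply_le' (fun hy => ?_) fun _ => by positivity
        refine pow_le_pow_left₀ (unitWeight_pos hy).le ?_ 2
        rw [mem_Ioo, not_and_or, not_lt, not_lt] at hx
        rcases hx with hx | hx
        · exact le_trans (by nlinarith [hy.1, hy.2]) (le_abs_self _)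
        · exact le_trans (by nlinarith [hy.1, hy.2]) (neg_le_abs _)
      simpa using (hO.hasFDerivAt (by norm_num)).hasDerivAt

end Tame

end Eignet

/-! ### The mask in the variable of the heat semigroup -/

namespace Eignet

variable {ι : Type*}

lemma tame_iteratedDeriv {F : ℝ → ℝ} {S : ℕ} (hF : ContDiff ℝ S F) {C : ℝ}
    (hC : ∀ k ≤ S, ∀ t, |iteratedDeriv k F t| ≤ C) (k j : ℕ) (hjk : j + k ≤ S) :
    Tame univ (fun _ => 1) k (fun _ : ι => iteratedDeriv j F) := by
  have hb : ∀ j ≤ S, ∃ (C : ℝ) (m : ℕ), 0 ≤ C ∧ ∀ _i : ι, ∀ x ∈ (univ : Set ℝ),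
      |iteratedDeriv j F x| ≤ C * (fun _ => (1 : ℝ)) x ^ m := fun j hj =>
    ⟨C, 0, (abs_nonneg _).trans (hC j hj 0), fun _ x _ => by simpa using hC j hj x⟩
  induction k generalizing j with
  | zero => exact hb j (by omega)
  | succ k ih =>
    refine ⟨hb j (by omega), fun _ => iteratedDeriv (j + 1) F, fun _ x _ => ?_,
      ih (j + 1) (by omega)⟩
    rw [iteratedDeriv_succ]
    refine DifferentiableAt.hasDerivAt ?_
    exact hF.differentiable_iteratedDeriv j (by exact_mod_cast (by omega : j < S)) x

lemma one_le_one_fun : ∀ x ∈ (univ : Set ℝ), (1 : ℝ) ≤ (fun _ => (1 : ℝ)) x := fun _ _ => le_rfl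

lemma hasDerivAt_one_add_exp_neg (s : ℝ) :
    HasDerivAt (fun s : ℝ => 1 + Real.exp (-s)) (-Real.exp (-s)) s := by
  simpa using ((hasDerivAt_neg s).exp).const_add 1

/-- The logistic function has bounded derivatives of all orders. -/
lemma tame_logistic (k : ℕ) :
    Tame univ (fun _ => 1) k (fun (_ : ι) (s : ℝ) => (1 + Real.exp (-s))⁻¹) := by
  have hb : ∃ (C : ℝ) (m : ℕ), 0 ≤ C ∧ ∀ _i : ι, ∀ s ∈ (univ : Set ℝ),
      |(1 + Real.exp (-s))⁻¹| ≤ C * (fun _ => (1 : ℝ)) s ^ m := by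
    refine ⟨1, 0, zero_le_one, fun _ s _ => ?_⟩
    have := Real.exp_pos (-s)
    rw [abs_of_pos (by positivity)]
    simpa using inv_le_one_of_one_le₀ (by linarith : 1 ≤ 1 + Real.exp (-s))
  induction k with
  | zero => exact hb
  | succ k ih =>
    refine ⟨hb, fun _ s => (1 + Real.exp (-s))⁻¹ * (1 + (-1) * (1 + Real.exp (-s))⁻¹),
      fun _ s _ => ?_, Tame.mul one_le_one_fun ih
        (Tame.add one_le_one_fun (Tame.const 1) (Tame.const_mul one_le_one_fun (-1) ih))⟩
    have h0 : 1 + Real.exp (-s) ≠ 0 := by positivity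
    refine ((hasDerivAt_one_add_exp_neg s).fun_inv h0).congr_deriv ?_
    field_simp
    ring

lemma tame_logistic_rpow {β : ℝ} (hβ : 0 ≤ β) (k : ℕ) :
    Tame univ (fun _ => 1) k (fun (_ : ι) (s : ℝ) => (1 + Real.exp (-s)) ^ (-β)) := by
  have hb : ∃ (C : ℝ) (m : ℕ), 0 ≤ C ∧ ∀ _i : ι, ∀ s ∈ (univ : Set ℝ),
      |(1 + Real.exp (-s)) ^ (-β)| ≤ C * (fun _ => (1 : ℝ)) s ^ m := by
    refine ⟨1, 0, zero_le_one, fun _ s _ => ?_⟩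
    have := Real.exp_pos (-s)
    rw [abs_of_pos (by positivity)]
    simpa using Real.rpow_le_one_of_one_le_of_nonpos (by linarith : 1 ≤ 1 + Real.exp (-s))
      (by linarith : -β ≤ 0)
  induction k with
  | zero => exact hb
  | succ k ih =>
    refine ⟨hb, fun _ s => β * ((1 + Real.exp (-s)) ^ (-β) * (1 + (-1) * (1 + Real.exp (-s))⁻¹)),
      fun _ s _ => ?_, Tame.const_mul one_le_one_fun β (Tame.mul one_le_one_fun ih
        (Tame.add one_le_one_fun (Tame.const 1)
          (Tame.const_mul one_le_one_fun (-1) (tame_logistic k))))⟩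
    have h0 : 0 < 1 + Real.exp (-s) := by positivity
    refine ((hasDerivAt_one_add_exp_neg s).rpow_const (p := -β) (Or.inl h0.ne')).congr_deriv ?_
    rw [Real.rpow_sub_one h0.ne']
    field_simp
    ring

lemma log_neg_of_mem {x : ℝ} (hx : x ∈ Ioo (0 : ℝ) 1) : Real.log x < 0 :=
  Real.log_neg hx.1 hx.2

lemma inv_neg_log_le {x : ℝ} (hx : x ∈ Ioo (0 : ℝ) 1) : (-Real.log x)⁻¹ ≤ (x * (1 - x))⁻¹ := by
  refine inv_anti₀ (Tame.unitWeight_pos hx) ?_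
  have := Real.log_le_sub_one_of_pos hx.1
  nlinarith [hx.1, hx.2]

lemma tame_inv (k : ℕ) :
    Tame (Ioo 0 1) (fun x => (x * (1 - x))⁻¹) k (fun (_ : ι) (x : ℝ) => x⁻¹) := by
  have hb : ∃ (C : ℝ) (m : ℕ), 0 ≤ C ∧ ∀ _i : ι, ∀ x ∈ Ioo (0 : ℝ) 1,
      |x⁻¹| ≤ C * ((x * (1 - x))⁻¹) ^ m := by
    refine ⟨1, 1, zero_le_one, fun _ x hx => ?_⟩
    rw [abs_of_pos (inv_pos.2 hx.1), one_mul, pow_one]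
    exact inv_anti₀ (Tame.unitWeight_pos hx) (by nlinarith [hx.1])
  induction k with
  | zero => exact hb
  | succ k ih =>
    refine ⟨hb, fun _ x => (-1) * (x⁻¹ * x⁻¹), fun _ x hx => ?_,
      Tame.const_mul (fun x hx => Tame.one_le_inv_unitWeight hx) (-1)
        (Tame.mul (fun x hx => Tame.one_le_inv_unitWeight hx) ih ih)⟩
    refine (hasDerivAt_inv hx.1.ne').congr_deriv ?_
    rw [pow_two, mul_inv]
    ring

lemma tame_inv_log (k : ℕ) :
    Tame (Ioo 0 1) (fun x => (x * (1 - x))⁻¹) k (fun (_ : ι) (x : ℝ) => (Real.log x)⁻¹) := by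
  have hb : ∃ (C : ℝ) (m : ℕ), 0 ≤ C ∧ ∀ _i : ι, ∀ x ∈ Ioo (0 : ℝ) 1,
      |(Real.log x)⁻¹| ≤ C * ((x * (1 - x))⁻¹) ^ m := by
    refine ⟨1, 1, zero_le_one, fun _ x hx => ?_⟩
    rw [abs_inv, abs_of_neg (log_neg_of_mem hx), one_mul, pow_one]
    exact inv_neg_log_le hx
  have hw : ∀ x ∈ Ioo (0 : ℝ) 1, 1 ≤ (x * (1 - x))⁻¹ := fun x hx => Tame.one_le_inv_unitWeight hx
  induction k with
  | zero => exact hb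
  | succ k ih =>
    refine ⟨hb, fun _ x => (-1) * ((Real.log x)⁻¹ * (Real.log x)⁻¹ * x⁻¹), fun _ x hx => ?_,
      Tame.const_mul hw (-1) (Tame.mul hw (Tame.mul hw ih ih) (tame_inv k))⟩
    refine ((Real.hasDerivAt_log hx.1.ne').fun_inv (log_neg_of_mem hx).ne).congr_deriv ?_
    have := (log_neg_of_mem hx).ne
    have := hx.1.ne'
    field_simp

lemma tame_neg_log_rpow {a : ℝ} (ha : 0 ≤ a) (k : ℕ) :
    Tame (Ioo 0 1) (fun x => (x * (1 - x))⁻¹) k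
      (fun (_ : ι) (x : ℝ) => (-Real.log x) ^ (-a)) := by
  have hw : ∀ x ∈ Ioo (0 : ℝ) 1, 1 ≤ (x * (1 - x))⁻¹ := fun x hx => Tame.one_le_inv_unitWeight hx
  have hb : ∃ (C : ℝ) (m : ℕ), 0 ≤ C ∧ ∀ _i : ι, ∀ x ∈ Ioo (0 : ℝ) 1,
      |(-Real.log x) ^ (-a)| ≤ C * ((x * (1 - x))⁻¹) ^ m := by
    obtain ⟨m, hm⟩ := exists_nat_ge a
    refine ⟨1, m, zero_le_one, fun _ x hx => ?_⟩
    have hl : 0 < -Real.log x := by linarith [log_neg_of_mem hx]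
    rw [abs_of_pos (by positivity), one_mul, Real.rpow_neg hl.le, ← Real.inv_rpow hl.le,
      ← Real.rpow_natCast]
    exact (Real.rpow_le_rpow (by positivity) (inv_neg_log_le hx) ha).trans
      (Real.rpow_le_rpow_of_exponent_le (hw x hx) hm)
  induction k with
  | zero => exact hb
  | succ k ih =>
    refine ⟨hb, fun _ x => (-a) * ((-Real.log x) ^ (-a) * (Real.log x)⁻¹ * x⁻¹), fun _ x hx => ?_,
      Tame.const_mul hw (-a) (Tame.mul hw (Tame.mul hw ih (tame_inv_log k)) (tame_inv k))⟩
    have hl : 0 < -Real.log x := by linarith [log_neg_of_mem hx]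
    refine ((Real.hasDerivAt_log hx.1.ne').fun_neg.rpow_const
      (p := -a) (Or.inl hl.ne')).congr_deriv ?_
    rw [Real.rpow_sub_one hl.ne']
    have := (log_neg_of_mem hx).ne
    have := hx.1.ne'
    field_simp

lemma hasDerivAt_half_log_neg_log {x : ℝ} (hx : x ∈ Ioo (0 : ℝ) 1) (c : ℝ) :
    HasDerivAt (fun x => 1 / 2 * Real.log (-Real.log x) + c)
      (1 / 2 * ((Real.log x)⁻¹ * x⁻¹)) x := by
  have hl : 0 < -Real.log x := by linarith [log_neg_of_mem hx]
  refine ((((Real.hasDerivAt_log hx.1.ne').fun_neg.log hl.ne').const_mul (1 / 2)).add_const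
    c).congr_deriv ?_
  have := (log_neg_of_mem hx).ne
  have := hx.1.ne'
  field_simp

/-- In the variable `X = exp(-(ℓ / L)²)`, a mask of type `β` at scale `L`, multiplied by
`L ^ β (X (1 - X)) ^ N`, has derivatives of order at most `S` that are bounded uniformly in `L`. -/
lemma IsMask.exists_profile {S : ℕ} {β : ℝ} {b : ℝ → ℝ} (hb : IsMask S β b) (hβ : 0 < β) :
    ∃ (N : ℕ) (f : ℝ → ℝ → ℝ), 1 ≤ N ∧ Tame univ (fun _ => 1) S f ∧
      ∀ L, 0 < L → ∀ u, 0 ≤ u →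
        (Real.exp (-u ^ 2) * (1 - Real.exp (-u ^ 2))) ^ N * b (L * u) =
          L ^ (-β) * f L (Real.exp (-u ^ 2)) := by
  obtain ⟨-, hbS, F, hF, ⟨C, hC⟩, -⟩ := hb
  have hFS : ContDiff ℝ S F := by
    have e : F = fun s => b (Real.exp s) * (1 + Real.exp s) ^ β := by
      funext s
      rw [hF _ (Real.exp_pos s), Real.log_exp, Real.rpow_neg (by positivity)]
      have : (1 + Real.exp s) ^ β ≠ 0 := by positivity
      field_simp
    rw [e]
    refine (hbS.comp Real.contDiff_exp).mul ?_
    exact (contDiff_const.add Real.contDiff_exp).rpow_const_of_ne fun s => by positivity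
  have hFt : Tame univ (fun _ => 1) S (fun _ : ℝ => F) := by
    simpa using tame_iteratedDeriv (ι := ℝ) hFS hC S 0 (by simp)
  have hw : ∀ x ∈ Ioo (0 : ℝ) 1, 1 ≤ (x * (1 - x))⁻¹ := fun x hx => Tame.one_le_inv_unitWeight hx
  have h1 : Tame (Ioo 0 1) (fun x => (x * (1 - x))⁻¹) S (fun (L x : ℝ) =>
      (1 + Real.exp (-(1 / 2 * Real.log (-Real.log x) + Real.log L))) ^ (-β) *
        F (1 / 2 * Real.log (-Real.log x) + Real.log L)) :=
    Tame.comp hw (Tame.mul one_le_one_fun (tame_logistic_rpow hβ.le S) hFt)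
      (v := fun L x => 1 / 2 * Real.log (-Real.log x) + Real.log L)
      (fun L x hx => hasDerivAt_half_log_neg_log hx _)
      (Tame.const_mul hw (1 / 2) (Tame.mul hw (tame_inv_log S) (tame_inv S)))
  have h2 := Tame.mul hw h1 (tame_neg_log_rpow (half_pos hβ).le S)
  obtain ⟨N₀, hN₀⟩ := h2.exists_extend
  refine ⟨N₀ + 1, _, Nat.le_add_left _ _, hN₀ (N₀ + 1) (Nat.le_succ _), fun L hL u hu => ?_⟩
  rcases hu.eq_or_lt with rfl | hu
  · simp
  have hX : Real.exp (-u ^ 2) ∈ Ioo (0 : ℝ) 1 :=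
    ⟨Real.exp_pos _, by rw [Real.exp_lt_one_iff]; nlinarith⟩
  have hLu : 0 < L * u := by positivity
  have hv : 1 / 2 * Real.log (-Real.log (Real.exp (-u ^ 2))) + Real.log L = Real.log (L * u) := by
    rw [Real.log_exp, neg_neg, Real.log_pow, Real.log_mul hL.ne' hu.ne']
    push_cast
    ring
  have hp : (-Real.log (Real.exp (-u ^ 2))) ^ (-(β / 2)) = u ^ (-β) := by
    rw [Real.log_exp, neg_neg, ← Real.rpow_natCast, ← Real.rpow_mul hu.le]
    congr 1
    push_cast
    ring
  rw [indicator_of_mem hX, hv, hp, hF _ hLu, Real.exp_neg (Real.log _), Real.exp_log hLu]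
  have e : (1 + L * u) ^ (-β) = L ^ (-β) * ((1 + (L * u)⁻¹) ^ (-β) * u ^ (-β)) := by
    rw [← Real.mul_rpow (by positivity) hu.le, ← Real.mul_rpow hL.le (by positivity)]
    congr 1
    field_simp
    ring
  rw [e]
  ring

end Eignet

/-! ### Cosine series with weighted absolutely summable coefficients -/

namespace Eignet

variable {ι : Type*}

/-- The Fourier coefficients over `[0, 2π]` of a real function. -/
noncomputable def circleCoeff (f : ℝ → ℝ) (n : ℤ) : ℂ :=
  fourierCoeffOn Real.two_pi_pos (fun x => (f x : ℂ)) n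

lemma norm_circleCoeff_le {f : ℝ → ℝ} {C : ℝ} (hf : ∀ x, |f x| ≤ C) (n : ℤ) :
    ‖circleCoeff f n‖ ≤ C := by
  rw [circleCoeff, fourierCoeffOn_eq_integral, norm_smul]
  have h := intervalIntegral.norm_integral_le_of_norm_le_const (a := 0) (b := 2 * Real.pi)
    (f := fun x : ℝ => (fourier (-n)) (x : AddCircle (2 * Real.pi - 0)) • (f x : ℂ)) (C := C)
    (fun x _ => by
      rw [norm_smul, Complex.norm_real, Real.norm_eq_abs, fourier_apply, Circle.norm_coe, one_mul]
      exact hf x)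
  have hpi := Real.two_pi_pos
  rw [sub_zero, abs_of_pos hpi] at h
  rw [sub_zero, Real.norm_of_nonneg (by positivity)]
  calc 1 / (2 * Real.pi) * _ ≤ 1 / (2 * Real.pi) * (C * (2 * Real.pi)) := by
        gcongr
    _ = C := by field_simp

lemma intervalIntegrable_of_bounded {f : ℝ → ℝ} (hm : Measurable f) {C : ℝ}
    (hf : ∀ x, |f x| ≤ C) (a b : ℝ) : IntervalIntegrable (fun x => (f x : ℂ)) volume a b := by
  rw [intervalIntegrable_iff]
  refine Measure.integrableOn_of_bounded (M := C) (by simp)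
    (Complex.measurable_ofReal.comp hm).aestronglyMeasurable (ae_of_all _ fun x => ?_)
  simpa using hf x

lemma norm_circleCoeff_deriv {f f' : ℝ → ℝ} (hd : ∀ x, HasDerivAt f (f' x) x)
    (hper : Function.Periodic f (2 * Real.pi)) (hm : Measurable f') {C : ℝ}
    (hC : ∀ x, |f' x| ≤ C) (n : ℤ) (hn : n ≠ 0) :
    |(n : ℝ)| * ‖circleCoeff f n‖ = ‖circleCoeff f' n‖ := by
  have h := fourierCoeffOn_of_hasDerivAt Real.two_pi_pos (f := fun x => (f x : ℂ))
    (f' := fun x => (f' x : ℂ)) hn (fun x _ => (hd x).ofReal_comp)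
    (intervalIntegrable_of_bounded hm hC _ _)
  have h0 : f (2 * Real.pi) = f 0 := by simpa using hper 0
  simp only [h0, sub_self, mul_zero, zero_sub] at h
  rw [circleCoeff, circleCoeff, h]
  have hn' : |(n : ℝ)| ≠ 0 := by simpa using hn
  have hpi := Real.pi_pos.ne'
  simp only [norm_mul, norm_div, norm_one, norm_neg, Complex.norm_I, Complex.norm_real,
    Complex.norm_ofNat, Complex.norm_intCast, Complex.ofReal_zero, sub_zero, Real.norm_eq_abs,
    Complex.ofReal_mul, Complex.ofReal_ofNat, abs_of_pos Real.pi_pos]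
  field_simp

lemma periodic_of_hasDerivAt {f f' : ℝ → ℝ} {T : ℝ} (hd : ∀ x, HasDerivAt f (f' x) x)
    (hper : Function.Periodic f T) : Function.Periodic f' T := by
  intro x
  have h1 : HasDerivAt (fun y => f (y + T)) (f' (x + T)) x := (hd (x + T)).comp_add_const x T
  have e : (fun y => f (y + T)) = f := funext hper
  rw [e] at h1
  exact h1.unique (hd x)

/-- Repeated integration by parts. -/
lemma Tame.exists_coeff_bound {k : ℕ} {H : ι → ℝ → ℝ} (hH : Tame univ (fun _ => 1) (k + 1) H)
    (hper : ∀ i, Function.Periodic (H i) (2 * Real.pi)) :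
    ∃ C : ℝ, 0 ≤ C ∧ ∃ T : ι → ℝ → ℝ, (∀ i, Measurable (T i)) ∧ (∀ i x, |T i x| ≤ C) ∧
      ∀ i (n : ℤ), n ≠ 0 → |(n : ℝ)| ^ (k + 1) * ‖circleCoeff (H i) n‖ =
        ‖circleCoeff (T i) n‖ := by
  induction k generalizing H with
  | zero =>
    obtain ⟨-, T, hd, C, m, hC, hb⟩ := hH
    have hm : ∀ i, Measurable (T i) := fun i => by
      rw [← funext fun x => (hd i x (mem_univ x)).deriv]
      exact measurable_deriv _
    have hb' : ∀ i x, |T i x| ≤ C := fun i x => by simpa using hb i x (mem_univ x)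
    refine ⟨C, hC, T, hm, hb', fun i n hn => ?_⟩
    rw [zero_add, pow_one]
    exact norm_circleCoeff_deriv (fun x => hd i x (mem_univ x)) (hper i) (hm i) (hb' i) n hn
  | succ k ih =>
    obtain ⟨-, g, hd, hg⟩ := hH
    obtain ⟨D, m, -, hb⟩ := hg.bound
    have hm : ∀ i, Measurable (g i) := fun i => by
      rw [← funext fun x => (hd i x (mem_univ x)).deriv]
      exact measurable_deriv _
    have hb' : ∀ i x, |g i x| ≤ D := fun i x => by simpa using hb i x (mem_univ x)
    obtain ⟨C, hC, T, hT, hTb, hTc⟩ := ih hg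
      fun i => periodic_of_hasDerivAt (fun x => hd i x (mem_univ x)) (hper i)
    refine ⟨C, hC, T, hT, hTb, fun i n hn => ?_⟩
    rw [← hTc i n hn, ← norm_circleCoeff_deriv (fun x => hd i x (mem_univ x)) (hper i) (hm i)
      (hb' i) n hn]
    ring

/-- Bessel's inequality for a bounded function. -/
lemma sum_sq_circleCoeff_le {f : ℝ → ℝ} (hm : Measurable f) {C : ℝ} (hf : ∀ x, |f x| ≤ C) :
    Summable (fun n => ‖circleCoeff f n‖ ^ 2) ∧ ∑' n, ‖circleCoeff f n‖ ^ 2 ≤ C ^ 2 := by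
  have hpi := Real.two_pi_pos
  have hL : MemLp (fun x => (f x : ℂ)) 2 (volume.restrict (Ioc 0 (2 * Real.pi))) :=
    MemLp.of_bound (Complex.measurable_ofReal.comp hm).aestronglyMeasurable C
      (ae_of_all _ fun x => by simpa using hf x)
  have h := hasSum_sq_fourierCoeffOn Real.two_pi_pos hL
  refine ⟨h.summable, h.tsum_eq.trans_le ?_⟩
  have hb : ∫ x in (0 : ℝ)..2 * Real.pi, ‖(f x : ℂ)‖ ^ 2 ≤ C ^ 2 * (2 * Real.pi) := by
    refine (le_abs_self _).trans ?_
    have := intervalIntegral.norm_integral_le_of_norm_le_const (a := 0) (b := 2 * Real.pi)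
      (f := fun x : ℝ => ‖(f x : ℂ)‖ ^ 2) (C := C ^ 2) (fun x _ => by
        rw [norm_pow, norm_norm, Complex.norm_real, Real.norm_eq_abs]
        exact pow_le_pow_left₀ (abs_nonneg _) (hf x) 2)
    rwa [sub_zero, abs_of_pos hpi] at this
  rw [sub_zero, smul_eq_mul, inv_mul_le_iff₀ hpi]
  linarith

lemma hasSum_circleCoeff {f : ℝ → ℝ} (hc : Continuous f)
    (hper : Function.Periodic f (2 * Real.pi)) (hs : Summable fun n => ‖circleCoeff f n‖) (θ : ℝ) :
    HasSum (fun n : ℤ => circleCoeff f n * Complex.exp (n * θ * Complex.I)) (f θ : ℂ) := by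
  have : Fact (0 < 2 * Real.pi) := ⟨Real.two_pi_pos⟩
  have hper' : Function.Periodic (fun x => (f x : ℂ)) (2 * Real.pi) := fun x => by simp [hper x]
  let g : C(AddCircle (2 * Real.pi), ℂ) :=
    ⟨hper'.lift, continuous_coinduced_dom.mpr (Complex.continuous_ofReal.comp hc)⟩
  have hg : ∀ x : ℝ, g (x : AddCircle (2 * Real.pi)) = (f x : ℂ) := fun x => hper'.lift_coe x
  have hcoe : ∀ n, fourierCoeff g n = circleCoeff f n := by
    intro n
    rw [fourierCoeff_eq_intervalIntegral _ n 0, circleCoeff, fourierCoeffOn_eq_integral]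
    simp only [hg, fourier_coe_apply, zero_add, sub_zero]
  have hsum : Summable (fourierCoeff g) := by
    rw [funext hcoe]
    exact hs.of_norm
  have h := has_pointwise_sum_fourier_series_of_summable hsum (θ : AddCircle (2 * Real.pi))
  rw [hg] at h
  convert h using 2 with n
  rw [hcoe, smul_eq_mul, fourier_coe_apply]
  congr 2
  have := Real.pi_pos.ne'
  push_cast
  field_simp

lemma summable_int_rpow {s : ℝ} (hs : 1 < s) : Summable fun n : ℤ => |(n : ℝ)| ^ (-s) := by
  refine Summable.of_nat_of_neg ?_ ?_ <;>
    simpa using Real.summable_nat_rpow.2 (by linarith : -s < -1)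

/-- An even periodic family with `S` bounded derivatives has cosine expansions whose coefficients
are summable with the weight `(1 + |n|) ^ σ`, for every `σ < S - 1 / 2`. -/
lemma Tame.exists_cos_expansion {S : ℕ} (hS : 1 ≤ S) {σ : ℝ} (hσ0 : 0 ≤ σ) (hσ : σ < S - 1 / 2)
    {H : ι → ℝ → ℝ} (hH : Tame univ (fun _ => 1) S H)
    (hper : ∀ i, Function.Periodic (H i) (2 * Real.pi)) (heven : ∀ i x, H i (-x) = H i x) :
    ∃ B : ℝ, 0 ≤ B ∧ ∃ c : ι → ℤ → ℝ, ∀ i,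
      Summable (fun n => |c i n| * (1 + |(n : ℝ)|) ^ σ) ∧
      ∑' n, |c i n| * (1 + |(n : ℝ)|) ^ σ ≤ B ∧
      ∀ θ, HasSum (fun n : ℤ => c i n * Real.cos (n * θ)) (H i θ) := by
  obtain ⟨k, rfl⟩ : ∃ k, S = k + 1 := ⟨S - 1, by omega⟩
  obtain ⟨C, hC, T, hT, hTb, hTc⟩ := hH.exists_coeff_bound hper
  obtain ⟨C₀, m, hC₀, hb₀⟩ := hH.bound
  have hb₀' : ∀ i x, |H i x| ≤ C₀ := fun i x => by simpa using hb₀ i x (mem_univ x)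
  have hcont : ∀ i, Continuous (H i) := fun i => by
    obtain ⟨-, g, hd, -⟩ := hH
    exact continuous_iff_continuousAt.2 fun x => (hd i x (mem_univ x)).continuousAt
  set s : ℝ := 2 * ((k + 1 : ℕ) - σ) with hs
  have hs1 : 1 < s := by linarith
  have hsum := summable_int_rpow hs1
  -- For `n ≠ 0`, the product of `|n| ^ S ‖cₙ‖` and `|n| ^ (σ - S)` is split by `2ab ≤ a² + b²`.
  have hmain : ∀ i (n : ℤ), ‖circleCoeff (H i) n‖ * (1 + |(n : ℝ)|) ^ σ ≤
      (if n = 0 then C₀ else 0) +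
        2 ^ σ * (‖circleCoeff (T i) n‖ ^ 2 + |(n : ℝ)| ^ (-s)) := by
    intro i n
    by_cases hn : n = 0
    · subst hn
      have h1 := norm_circleCoeff_le (hb₀' i) 0
      have h2 : 0 ≤ (2 : ℝ) ^ σ * (‖circleCoeff (T i) 0‖ ^ 2 + |((0 : ℤ) : ℝ)| ^ (-s)) := by
        positivity
      simp only [Int.cast_zero, abs_zero, add_zero, Real.one_rpow, mul_one, if_true]
      simp only [Int.cast_zero, abs_zero] at h2
      linarith
    · have hn1 : (1 : ℝ) ≤ |(n : ℝ)| := by exact_mod_cast Int.one_le_abs hn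
      have hn0 : (0 : ℝ) < |(n : ℝ)| := by linarith
      rw [if_neg hn, zero_add]
      have h1 : (1 + |(n : ℝ)|) ^ σ ≤ 2 ^ σ * |(n : ℝ)| ^ σ := by
        rw [← Real.mul_rpow (by norm_num) hn0.le]
        exact Real.rpow_le_rpow (by positivity) (by linarith) hσ0
      have h2 : ‖circleCoeff (H i) n‖ * |(n : ℝ)| ^ σ =
          ‖circleCoeff (T i) n‖ * |(n : ℝ)| ^ (-s / 2) := by
        rw [← hTc i n hn]
        have : |(n : ℝ)| ^ (-s / 2) = |(n : ℝ)| ^ σ / |(n : ℝ)| ^ (k + 1) := by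
          rw [← Real.rpow_natCast, ← Real.rpow_sub hn0]
          congr 1
          rw [hs]
          ring
        rw [this]
        field_simp
      have h3 : |(n : ℝ)| ^ (-s) = (|(n : ℝ)| ^ (-s / 2)) ^ 2 := by
        rw [← Real.rpow_natCast, ← Real.rpow_mul hn0.le]
        congr 1
        push_cast
        ring
      have h4 : ‖circleCoeff (T i) n‖ * |(n : ℝ)| ^ (-s / 2) ≤
          ‖circleCoeff (T i) n‖ ^ 2 + |(n : ℝ)| ^ (-s) := by
        rw [h3]
        nlinarith [sq_nonneg (‖circleCoeff (T i) n‖ - |(n : ℝ)| ^ (-s / 2)),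
          sq_nonneg (‖circleCoeff (T i) n‖), sq_nonneg (|(n : ℝ)| ^ (-s / 2))]
      calc ‖circleCoeff (H i) n‖ * (1 + |(n : ℝ)|) ^ σ
          ≤ ‖circleCoeff (H i) n‖ * (2 ^ σ * |(n : ℝ)| ^ σ) := by gcongr
        _ = 2 ^ σ * (‖circleCoeff (H i) n‖ * |(n : ℝ)| ^ σ) := by ring
        _ ≤ _ := by
            rw [h2]
            gcongr
  have hbes := fun i => sum_sq_circleCoeff_le (hT i) (hTb i)
  have hdelta : HasSum (fun n : ℤ => if n = 0 then C₀ else 0) C₀ := hasSum_ite_eq 0 C₀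
  have hmaj : ∀ i, Summable fun n : ℤ => (if n = 0 then C₀ else 0) +
      2 ^ σ * (‖circleCoeff (T i) n‖ ^ 2 + |(n : ℝ)| ^ (-s)) := fun i =>
    hdelta.summable.add (((hbes i).1.add hsum).mul_left _)
  have hre : ∀ i (n : ℤ), |(circleCoeff (H i) n).re| * (1 + |(n : ℝ)|) ^ σ ≤
      (if n = 0 then C₀ else 0) +
        2 ^ σ * (‖circleCoeff (T i) n‖ ^ 2 + |(n : ℝ)| ^ (-s)) := fun i n =>
    (mul_le_mul_of_nonneg_right (Complex.abs_re_le_norm _) (by positivity)).trans (hmain i n)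
  have hsre := fun i => Summable.of_nonneg_of_le (fun n => by positivity) (hre i) (hmaj i)
  refine ⟨C₀ + 2 ^ σ * (C ^ 2 + ∑' n : ℤ, |(n : ℝ)| ^ (-s)), ?_,
    fun i n => (circleCoeff (H i) n).re, fun i => ⟨hsre i, ?_, fun θ => ?_⟩⟩
  · have : 0 ≤ ∑' n : ℤ, |(n : ℝ)| ^ (-s) := tsum_nonneg fun n => by positivity
    positivity
  · refine ((hsre i).tsum_le_tsum (hre i) (hmaj i)).trans ?_
    rw [hdelta.summable.tsum_add (((hbes i).1.add hsum).mul_left _), hdelta.tsum_eq,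
      tsum_mul_left, (hbes i).1.tsum_add hsum]
    gcongr
    exact (hbes i).2
  · have hsn : Summable fun n => ‖circleCoeff (H i) n‖ := by
      refine Summable.of_nonneg_of_le (fun n => norm_nonneg _) (fun n => ?_) (hmaj i)
      refine le_trans ?_ (hmain i n)
      exact le_mul_of_one_le_right (norm_nonneg _)
        (Real.one_le_rpow (by linarith [abs_nonneg (n : ℝ)]) hσ0)
    have h1 := Complex.hasSum_re (hasSum_circleCoeff (hcont i) (hper i) hsn θ)
    have h2 := Complex.hasSum_re (hasSum_circleCoeff (hcont i) (hper i) hsn (-θ))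
    have h3 := (h1.add h2).mul_left (1 / 2)
    rw [Complex.ofReal_re, Complex.ofReal_re, heven,
      show 1 / 2 * (H i θ + H i θ) = H i θ by ring] at h3
    refine Eq.subst (motive := fun F : ℤ → ℝ => HasSum F (H i θ)) (funext fun n => ?_) h3
    have e1 : Complex.exp (n * θ * Complex.I) =
        (Real.cos (n * θ) : ℂ) + (Real.sin (n * θ) : ℂ) * Complex.I := by
      rw [Complex.exp_mul_I]
      push_cast
      rfl
    have e2 : Complex.exp (n * ((-θ : ℝ) : ℂ) * Complex.I) =
        (Real.cos (n * θ) : ℂ) - (Real.sin (n * θ) : ℂ) * Complex.I := by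
      rw [Complex.exp_mul_I]
      push_cast
      rw [mul_neg, Complex.cos_neg, Complex.sin_neg]
      ring
    rw [e1, e2]
    simp only [Complex.mul_re, Complex.add_re, Complex.sub_re, Complex.add_im, Complex.sub_im,
      Complex.ofReal_re, Complex.ofReal_im, Complex.I_re, Complex.I_im, Complex.mul_im]
    ring

end Eignet

/-! ### Localization of the kernels of smooth multipliers -/

namespace Eignet

/-- The multiplier `X ^ a cos(n θ)` where `X = exp(-(ℓⱼ / L)²)` and `cos θ = 2 X - 1`, that is,
`X ^ a` times the `n`-th Chebyshev polynomial of `2 X - 1`. -/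
noncomputable def cosMult (ℓ : ℕ → ℝ) (L : ℝ) (a n j : ℕ) : ℝ :=
  gaussMult ℓ L j ^ a * Real.cos (n * Real.arccos (2 * gaussMult ℓ L j - 1))

lemma cos_arccos_gaussMult (ℓ : ℕ → ℝ) (L : ℝ) (j : ℕ) :
    Real.cos (Real.arccos (2 * gaussMult ℓ L j - 1)) = 2 * gaussMult ℓ L j - 1 :=
  Real.cos_arccos (by linarith [gaussMult_pos ℓ L j]) (by linarith [gaussMult_le_one ℓ L j])

lemma abs_pow_gaussMult_mul_le (ℓ : ℕ → ℝ) (L : ℝ) {a : ℕ} (ha : 1 ≤ a) (j : ℕ) {r D : ℝ}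
    (hr : |r| ≤ D) : |gaussMult ℓ L j ^ a * r| ≤ D * gaussMult ℓ L j := by
  have h0 := gaussMult_pos ℓ L j
  rw [abs_mul, abs_of_pos (pow_pos h0 a), mul_comm D]
  refine mul_le_mul ?_ hr (abs_nonneg _) h0.le
  exact pow_le_of_le_one h0.le (gaussMult_le_one ℓ L j) (by omega)

lemma abs_cosMult_le (ℓ : ℕ → ℝ) (L : ℝ) {a : ℕ} (ha : 1 ≤ a) (n j : ℕ) :
    |cosMult ℓ L a n j| ≤ 1 * gaussMult ℓ L j :=
  abs_pow_gaussMult_mul_le ℓ L ha j (Real.abs_cos_le_one _)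

lemma cosMult_zero (ℓ : ℕ → ℝ) (L : ℝ) (a : ℕ) :
    cosMult ℓ L a 0 = fun j => gaussMult ℓ L j ^ a := by
  funext j
  simp [cosMult]

lemma cosMult_one (ℓ : ℕ → ℝ) (L : ℝ) (a : ℕ) :
    cosMult ℓ L a 1 = fun j => 2 * cosMult ℓ L (a + 1) 0 j + (-1) * cosMult ℓ L a 0 j := by
  funext j
  simp only [cosMult, Nat.cast_one, Nat.cast_zero, zero_mul, Real.cos_zero, one_mul,
    cos_arccos_gaussMult]
  ring

/-- The Chebyshev recurrence. -/
lemma cosMult_add_two (ℓ : ℕ → ℝ) (L : ℝ) (a n : ℕ) :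
    cosMult ℓ L a (n + 2) = fun j => 1 * (4 * cosMult ℓ L (a + 1) (n + 1) j +
      (-2) * cosMult ℓ L a (n + 1) j) + (-1) * cosMult ℓ L a n j := by
  funext j
  simp only [cosMult]
  set θ := Real.arccos (2 * gaussMult ℓ L j - 1) with hθ
  have hc : Real.cos θ = 2 * gaussMult ℓ L j - 1 := cos_arccos_gaussMult ℓ L j
  have e : Real.cos ((n + 2 : ℕ) * θ) =
      2 * Real.cos θ * Real.cos ((n + 1 : ℕ) * θ) - Real.cos (n * θ) := by
    have h1 : ((n + 2 : ℕ) : ℝ) * θ = (n + 1 : ℕ) * θ + θ := by push_cast; ring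
    have h2 : (n : ℝ) * θ = (n + 1 : ℕ) * θ - θ := by push_cast; ring
    rw [h1, h2, Real.cos_add, Real.cos_sub]
    ring
  rw [e, hc]
  ring

namespace IsGaussianSystem

section Pointwise

variable {M : Type*} [MetricSpace M] [MeasurableSpace M] {μ : Measure M}
  {φ : ℕ → M → ℝ} {ℓ : ℕ → ℝ} {α c₀ κ γ c₁ : ℝ} (h : IsGaussianSystem μ φ ℓ α c₀ κ γ c₁)
include h

/-- A polynomial of degree `n` in the heat semigroup at time `L⁻²` spreads the kernel only to
distance of order `n / L`, while the Chebyshev coefficients grow exponentially in `n`. -/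
lemma abs_cos_kernel_le {L : ℝ} (hL : 1 ≤ L) (n a : ℕ) (ha : 1 ≤ a)
    (haL : ((n + a : ℕ) : ℝ) ≤ L ^ 2) (x y : M) :
    |multKernel φ (cosMult ℓ L a n) x y| ≤
      7 ^ n * (κ * L ^ α * Real.exp (-(γ * (L * dist x y) ^ 2 / (n + a : ℕ)))) := by
  have hL0 : 0 < L := by linarith
  have hQ := h.isSpectralWeight hL
  have hκ := h.kappa_pos
  have hγ := h.gamma_pos
  have hLα : 0 < L ^ α := by positivity
  set e : ℕ → ℝ := fun k => κ * L ^ α * Real.exp (-(γ * (L * dist x y) ^ 2 / k)) with he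
  have hepos : ∀ k, 0 < e k := fun k => by positivity
  have hmono : ∀ k k' : ℕ, 1 ≤ k → k ≤ k' → e k ≤ e k' := by
    intro k k' hk hkk
    have : (0 : ℝ) < k := by exact_mod_cast hk
    have : (k : ℝ) ≤ k' := by exact_mod_cast hkk
    simp only [he]
    gcongr
  suffices H : ∀ n, (∀ a, 1 ≤ a → ((n + a : ℕ) : ℝ) ≤ L ^ 2 →
      |multKernel φ (cosMult ℓ L a n) x y| ≤ 7 ^ n * e (n + a)) ∧
      (∀ a, 1 ≤ a → ((n + 1 + a : ℕ) : ℝ) ≤ L ^ 2 →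
      |multKernel φ (cosMult ℓ L a (n + 1)) x y| ≤ 7 ^ (n + 1) * e (n + 1 + a)) from
    (H n).1 a ha haL
  have hcast : ∀ p q : ℕ, p ≤ q → (q : ℝ) ≤ L ^ 2 → (p : ℝ) ≤ L ^ 2 := fun p q hpq hq =>
    le_trans (by exact_mod_cast hpq) hq
  have h0 : ∀ a, 1 ≤ a → ((0 + a : ℕ) : ℝ) ≤ L ^ 2 →
      |multKernel φ (cosMult ℓ L a 0) x y| ≤ 7 ^ 0 * e (0 + a) := by
    intro a ha haL
    rw [cosMult_zero, pow_zero, one_mul, zero_add]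
    exact h.abs_gauss_pow_le hL0 ha (by simpa using haL) x y
  intro n
  induction n with
  | zero =>
    refine ⟨h0, fun a ha haL => ?_⟩
    rw [cosMult_one, hQ.multKernel_add (abs_cosMult_le ℓ L (by omega) 0)
      (abs_cosMult_le ℓ L ha 0)]
    have h1 := h0 (a + 1) (by omega) (hcast _ _ (by omega) haL)
    have h2 := h0 a ha (hcast _ _ (by omega) haL)
    have h3 := hmono (0 + (a + 1)) (0 + 1 + a) (by omega) (by omega)
    have h4 := hmono (0 + a) (0 + 1 + a) (by omega) (by omega)
    have h5 := hepos (0 + 1 + a)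
    rw [abs_le] at h1 h2 ⊢
    constructor <;> norm_num at * <;> linarith
  | succ n ih =>
    refine ⟨ih.2, fun a ha haL => ?_⟩
    rw [cosMult_add_two, hQ.multKernel_add (D₁ := 6) (fun j => ?_) (abs_cosMult_le ℓ L ha n),
      hQ.multKernel_add (abs_cosMult_le ℓ L (by omega) (n + 1)) (abs_cosMult_le ℓ L ha (n + 1))]
    · have h1 := ih.2 (a + 1) (by omega) (hcast _ _ (by omega) haL)
      have h2 := ih.2 a ha (hcast _ _ (by omega) haL)
      have h3 := ih.1 a ha (hcast _ _ (by omega) haL)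
      have p7 : (0 : ℝ) < 7 ^ n := by positivity
      have m1 := mul_le_mul_of_nonneg_left
        (hmono (n + 1 + (a + 1)) (n + 1 + 1 + a) (by omega) (by omega)) p7.le
      have m2 := mul_le_mul_of_nonneg_left
        (hmono (n + 1 + a) (n + 1 + 1 + a) (by omega) (by omega)) p7.le
      have m3 := mul_le_mul_of_nonneg_left
        (hmono (n + a) (n + 1 + 1 + a) (by omega) (by omega)) p7.le
      have m4 := mul_pos p7 (hepos (n + 1 + 1 + a))
      simp only [pow_succ] at h1 h2 h3 ⊢
      rw [abs_le] at h1 h2 h3 ⊢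
      constructor <;> nlinarith
    · have h1 := abs_cosMult_le ℓ L (show 1 ≤ a + 1 by omega) (n + 1) j
      have h2 := abs_cosMult_le ℓ L ha (n + 1) j
      rw [abs_le] at h1 h2 ⊢
      constructor <;> linarith

end Pointwise

section Moment

variable {M : Type*} [MetricSpace M] [CompactSpace M] [MeasurableSpace M] [BorelSpace M]
  {μ : Measure M} [IsProbabilityMeasure μ]
  {φ : ℕ → M → ℝ} {ℓ : ℕ → ℝ} {α c₀ κ γ c₁ : ℝ} (h : IsGaussianSystem μ φ ℓ α c₀ κ γ c₁)
include h

lemma lintegral_sq_le {L : ℝ} (hL : 1 ≤ L) {m : ℕ → ℝ} (hm : ∀ j, |m j| ≤ 1 * gaussMult ℓ L j)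
    (x : M) : ∫⁻ z, ENNReal.ofReal (multKernel φ m x z ^ 2) ∂μ ≤ ENNReal.ofReal (κ * L ^ α) := by
  have hQ := h.isSpectralWeight hL
  have e : ∀ z, multKernel φ m x z ^ 2 = multKernel φ m x z * multKernel φ m z x := fun z => by
    rw [multKernel_comm m z x, sq]
  have hbd : ∀ z, |multKernel φ m x z| ≤ 1 * (κ * L ^ α) := fun z =>
    hQ.abs_multKernel_le hm zero_le_one x z
  have hint : Integrable (fun z => multKernel φ m x z ^ 2) μ := by
    refine Integrable.of_bound ((measurable_multKernel h.continuous m x).pow_const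
      2).aestronglyMeasurable ((1 * (κ * L ^ α)) ^ 2) (ae_of_all _ fun z => ?_)
    rw [norm_pow, Real.norm_eq_abs]
    exact pow_le_pow_left₀ (abs_nonneg _) (hbd z) 2
  rw [← ofReal_integral_eq_lintegral_ofReal hint (ae_of_all _ fun z => sq_nonneg _)]
  refine ENNReal.ofReal_le_ofReal ?_
  simp only [e]
  rw [hQ.integral_multKernel_mul h.continuous h.orthonormal hm zero_le_one hm zero_le_one]
  have hle : ∀ j, m j * m j ≤ gaussMult ℓ L j := fun j => by
    have h1 := hm j
    have h0 := gaussMult_pos ℓ L j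
    have h2 := gaussMult_le_one ℓ L j
    rw [one_mul] at h1
    rw [← abs_mul_abs_self]
    nlinarith [abs_nonneg (m j)]
  refine le_trans (hQ.multKernel_self_mono (D₁ := 1) (D₂ := 1) (fun j => ?_) (fun j => ?_) hle x)
    (hQ.le x)
  · rw [abs_of_nonneg (mul_self_nonneg _), one_mul]
    exact hle j
  · rw [abs_of_pos (gaussMult_pos ℓ L j), one_mul]

/-- The Cauchy–Schwarz bound for the integral of a kernel over a set, in additive form: `η` is a
free parameter. -/
lemma setLIntegral_le {L : ℝ} (hL : 1 ≤ L) {m : ℕ → ℝ} (hm : ∀ j, |m j| ≤ 1 * gaussMult ℓ L j)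
    (x : M) (A : Set M) {η : ℝ} (hη : 0 < η) :
    ∫⁻ z in A, ‖multKernel φ m x z‖ₑ ∂μ ≤
      ENNReal.ofReal (η * (κ * L ^ α) + η⁻¹ * μ.real A) := by
  have hκ := h.kappa_pos
  have hLα : 0 < L ^ α := Real.rpow_pos_of_pos (by linarith) _
  calc ∫⁻ z in A, ‖multKernel φ m x z‖ₑ ∂μ
      ≤ ∫⁻ z in A, (ENNReal.ofReal η * ENNReal.ofReal (multKernel φ m x z ^ 2) +
          ENNReal.ofReal η⁻¹) ∂μ := by
        refine lintegral_mono fun z => ?_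
        rw [← ENNReal.ofReal_mul hη.le, ← ENNReal.ofReal_add (by positivity) (by positivity),
          Real.enorm_eq_ofReal_abs]
        refine ENNReal.ofReal_le_ofReal ?_
        set v := multKernel φ m x z
        rw [← sq_abs v]
        have h1 : 0 ≤ (η * |v| - 1) ^ 2 * η⁻¹ := by positivity
        have h2 : (η * |v| - 1) ^ 2 * η⁻¹ = η * |v| ^ 2 - 2 * |v| + η⁻¹ := by
          field_simp
          ring
        have h3 := abs_nonneg v
        linarith
    _ = ENNReal.ofReal η * ∫⁻ z in A, ENNReal.ofReal (multKernel φ m x z ^ 2) ∂μ +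
          ENNReal.ofReal η⁻¹ * μ A := by
        rw [lintegral_add_right _ measurable_const, lintegral_const_mul' _ _ ENNReal.ofReal_ne_top,
          setLIntegral_const]
    _ ≤ ENNReal.ofReal η * ENNReal.ofReal (κ * L ^ α) +
          ENNReal.ofReal η⁻¹ * ENNReal.ofReal (μ.real A) := by
        rw [ofReal_measureReal]
        gcongr
        exact (setLIntegral_le_lintegral _ _).trans (h.lintegral_sq_le hL hm x)
    _ = _ := by
        rw [← ENNReal.ofReal_mul hη.le, ← ENNReal.ofReal_mul (by positivity),
          ← ENNReal.ofReal_add (by positivity) (by positivity)]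

/-- Weighted `L¹` bound for the Chebyshev kernels, polynomial in the degree. -/
lemma exists_cos_moment {δ : ℝ} (hδ : 0 ≤ δ) (hδ1 : δ ≤ 1) :
    ∃ C : ℝ, 0 < C ∧ ∀ L : ℝ, 1 ≤ L → ∀ (n : ℕ) (x : M),
      ∫⁻ z, ‖multKernel φ (cosMult ℓ L 1 n) x z‖ₑ *
        ENNReal.ofReal ((1 + L * dist x z) ^ δ) ∂μ ≤
      ENNReal.ofReal (C * (1 + n) ^ (α / 2 + δ)) := by
  obtain ⟨C, hC, hint⟩ := h.exists_lintegral_exp_le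
  have hκ := h.kappa_pos
  have hγ := h.gamma_pos
  have hc₀ := h.ball_pos
  have hα := h.alpha_pos
  obtain ⟨Δ, hΔ0, hΔ⟩ : ∃ Δ : ℝ, 0 ≤ Δ ∧ ∀ x z : M, dist x z ≤ Δ :=
    ⟨Metric.diam (univ : Set M), Metric.diam_nonneg, fun x z =>
      Metric.dist_le_diam_of_mem isCompact_univ.isBounded (mem_univ x) (mem_univ z)⟩
  -- Beyond distance `A (n + 1) / L` the Gaussian decay beats the growth `7 ^ n`.
  set A : ℝ := 1 + 4 / γ with hA
  have hA1 : 1 ≤ A := by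
    have : 0 < 4 / γ := by positivity
    linarith
  have hA0 : 0 < A := by linarith
  refine ⟨(1 + Δ) ^ δ * (κ + 1) + ((1 + A) ^ δ * (κ + c₀ * A ^ α) + κ * C), by positivity,
    fun L hL n x => ?_⟩
  have hL0 : 0 < L := by linarith
  have hLα : 0 < L ^ α := by positivity
  have hn0 : (0 : ℝ) ≤ n := Nat.cast_nonneg n
  have hn1 : (1 : ℝ) ≤ 1 + n := by linarith
  have hnp : (0 : ℝ) < 1 + n := by linarith
  have hm := abs_cosMult_le ℓ L le_rfl n
  have hsplit : ((1 : ℝ) + n) ^ (α / 2 + δ) = (1 + n) ^ (α / 2) * (1 + n) ^ δ :=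
    Real.rpow_add hnp _ _
  have hmeas : Measurable fun z => ‖multKernel φ (cosMult ℓ L 1 n) x z‖ₑ :=
    (measurable_multKernel h.continuous _ x).enorm
  by_cases hcase : (1 : ℝ) + n ≤ L
  · set Bx := Metric.closedBall x (A * (1 + n) / L) with hBx
    have hBm : MeasurableSet Bx := Metric.isClosed_closedBall.measurableSet
    have hnL : ((n + 1 : ℕ) : ℝ) ≤ L ^ 2 := by
      push_cast
      nlinarith
    have hpt : ∀ z, ‖multKernel φ (cosMult ℓ L 1 n) x z‖ₑ *
        ENNReal.ofReal ((1 + L * dist x z) ^ δ) ≤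
        ENNReal.ofReal (((1 + A) * (1 + n)) ^ δ) *
          Bx.indicator (fun z => ‖multKernel φ (cosMult ℓ L 1 n) x z‖ₑ) z +
        ENNReal.ofReal (κ * L ^ α) * ENNReal.ofReal (Real.exp (-(L * dist x z))) := by
      intro z
      have hs0 : 0 ≤ L * dist x z := by positivity
      by_cases hz : z ∈ Bx
      · rw [indicator_of_mem hz, mul_comm]
        refine le_add_right ?_
        gcongr
        have h1 : L * dist x z ≤ A * (1 + n) := by
          have := (le_div_iff₀ hL0).1 (Metric.mem_closedBall'.1 hz)
          linarith
        nlinarith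
      · rw [indicator_of_notMem hz, mul_zero, zero_add, Real.enorm_eq_ofReal_abs,
          ← ENNReal.ofReal_mul (abs_nonneg _), ← ENNReal.ofReal_mul (by positivity)]
        refine ENNReal.ofReal_le_ofReal ?_
        set s := L * dist x z with hs
        have h1 : A * (1 + n) < s := by
          rw [hBx, Metric.mem_closedBall', not_le, div_lt_iff₀ hL0] at hz
          linarith
        have h2 : (1 + s) ^ δ ≤ Real.exp s :=
          calc (1 + s) ^ δ ≤ (1 + s) ^ (1 : ℝ) :=
                Real.rpow_le_rpow_of_exponent_le (by linarith) hδ1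
            _ = s + 1 := by rw [Real.rpow_one, add_comm]
            _ ≤ Real.exp s := Real.add_one_le_exp s
        have h3 := h.abs_cos_kernel_le hL n 1 le_rfl hnL x z
        have h4 : (7 : ℝ) ^ n ≤ Real.exp (2 * s) := by
          have h7 : (7 : ℝ) ≤ Real.exp 2 := by
            have := Real.exp_one_gt_d9
            rw [show (2 : ℝ) = 1 + 1 by norm_num, Real.exp_add]
            nlinarith
          calc (7 : ℝ) ^ n ≤ Real.exp 2 ^ n := pow_le_pow_left₀ (by norm_num) h7 n
            _ = Real.exp (n * 2) := (Real.exp_nat_mul 2 n).symm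
            _ ≤ Real.exp (2 * s) := Real.exp_le_exp.2 (by nlinarith)
        have h5 : 4 * s ≤ γ * s ^ 2 / (n + 1 : ℕ) := by
          rw [le_div_iff₀ (by positivity)]
          have : 4 * (1 + n) ≤ γ * s := by
            have e : γ * (A * (1 + n)) = (γ + 4) * (1 + n) := by
              rw [hA]
              field_simp
            nlinarith
          push_cast
          nlinarith
        calc |multKernel φ (cosMult ℓ L 1 n) x z| * (1 + s) ^ δ
            ≤ (7 ^ n * (κ * L ^ α * Real.exp (-(γ * s ^ 2 / (n + 1 : ℕ))))) * Real.exp s :=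
              mul_le_mul h3 h2 (by positivity) (by positivity)
          _ ≤ (Real.exp (2 * s) * (κ * L ^ α * Real.exp (-(4 * s)))) * Real.exp s := by
              gcongr
          _ = κ * L ^ α * (Real.exp (2 * s) * Real.exp (-(4 * s)) * Real.exp s) := by ring
          _ = κ * L ^ α * Real.exp (-s) := by
              rw [← Real.exp_add, ← Real.exp_add]
              congr 2
              ring
    have hball : μ.real Bx ≤ c₀ * (A ^ α * (1 + n) ^ α * (L ^ α)⁻¹) := by
      refine (h.ball x _ (by positivity)).trans (le_of_eq ?_)
      rw [Real.div_rpow (by positivity) hL0.le, Real.mul_rpow hA0.le hnp.le, div_eq_mul_inv]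
    have hnear := h.setLIntegral_le hL hm x Bx
      (η := (1 + n : ℝ) ^ (α / 2) * (L ^ α)⁻¹) (by positivity)
    have hpow : ((1 : ℝ) + n) ^ α = (1 + n) ^ (α / 2) * (1 + n) ^ (α / 2) := by
      rw [← Real.rpow_add hnp]
      congr 1
      ring
    have hnear' : ∫⁻ z in Bx, ‖multKernel φ (cosMult ℓ L 1 n) x z‖ₑ ∂μ ≤
        ENNReal.ofReal ((κ + c₀ * A ^ α) * (1 + n) ^ (α / 2)) := by
      refine hnear.trans (ENNReal.ofReal_le_ofReal ?_)
      have hp : (0 : ℝ) < (1 + n) ^ (α / 2) := by positivity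
      calc (1 + n : ℝ) ^ (α / 2) * (L ^ α)⁻¹ * (κ * L ^ α) +
            ((1 + n : ℝ) ^ (α / 2) * (L ^ α)⁻¹)⁻¹ * μ.real Bx
          ≤ (1 + n : ℝ) ^ (α / 2) * (L ^ α)⁻¹ * (κ * L ^ α) +
            ((1 + n : ℝ) ^ (α / 2) * (L ^ α)⁻¹)⁻¹ *
              (c₀ * (A ^ α * (1 + n) ^ α * (L ^ α)⁻¹)) := by gcongr
        _ = _ := by
            rw [hpow]
            field_simp
    calc _ ≤ ∫⁻ z, (ENNReal.ofReal (((1 + A) * (1 + n)) ^ δ) *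
          Bx.indicator (fun z => ‖multKernel φ (cosMult ℓ L 1 n) x z‖ₑ) z +
        ENNReal.ofReal (κ * L ^ α) * ENNReal.ofReal (Real.exp (-(L * dist x z)))) ∂μ :=
          lintegral_mono hpt
      _ = ENNReal.ofReal (((1 + A) * (1 + n)) ^ δ) *
          ∫⁻ z in Bx, ‖multKernel φ (cosMult ℓ L 1 n) x z‖ₑ ∂μ +
          ENNReal.ofReal (κ * L ^ α) * ∫⁻ z, ENNReal.ofReal (Real.exp (-(L * dist x z))) ∂μ := by
          rw [lintegral_add_left ((hmeas.indicator hBm).const_mul _),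
            lintegral_const_mul' _ _ ENNReal.ofReal_ne_top,
            lintegral_const_mul' _ _ ENNReal.ofReal_ne_top, lintegral_indicator hBm]
      _ ≤ ENNReal.ofReal (((1 + A) * (1 + n)) ^ δ) *
            ENNReal.ofReal ((κ + c₀ * A ^ α) * (1 + n) ^ (α / 2)) +
          ENNReal.ofReal (κ * L ^ α) * ENNReal.ofReal (C * L ^ (-α)) := by
          gcongr
          exact hint L hL0 x
      _ ≤ _ := by
          rw [← ENNReal.ofReal_mul (by positivity), ← ENNReal.ofReal_mul (by positivity),
            ← ENNReal.ofReal_add (by positivity) (by positivity)]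
          refine ENNReal.ofReal_le_ofReal ?_
          have h1 : (1 : ℝ) ≤ (1 + n) ^ (α / 2 + δ) := Real.one_le_rpow hn1 (by positivity)
          have h2 : κ * L ^ α * (C * L ^ (-α)) = κ * C := by
            rw [Real.rpow_neg hL0.le]
            field_simp
          have h3 : 0 ≤ (1 + Δ) ^ δ * (κ + 1) := by positivity
          have h4 : 0 < κ * C := by positivity
          rw [h2, Real.mul_rpow (by positivity) hnp.le]
          have h5 : (1 + A) ^ δ * (1 + n) ^ δ * ((κ + c₀ * A ^ α) * (1 + n) ^ (α / 2)) =
              (1 + A) ^ δ * (κ + c₀ * A ^ α) * (1 + n) ^ (α / 2 + δ) := by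
            rw [hsplit]
            ring
          rw [h5]
          nlinarith
  · -- The degree is so large that the whole space lies within distance of order `n / L`.
    push Not at hcase
    have hpt : ∀ z, ‖multKernel φ (cosMult ℓ L 1 n) x z‖ₑ *
        ENNReal.ofReal ((1 + L * dist x z) ^ δ) ≤
        ENNReal.ofReal (((1 + Δ) * (1 + n)) ^ δ) * ‖multKernel φ (cosMult ℓ L 1 n) x z‖ₑ := by
      intro z
      rw [mul_comm]
      gcongr
      have := hΔ x z
      nlinarith [dist_nonneg (x := x) (y := z)]
    have hall := h.setLIntegral_le hL hm x univ (η := (L ^ (α / 2))⁻¹) (by positivity)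
    rw [Measure.restrict_univ, probReal_univ] at hall
    have hpow : L ^ α = L ^ (α / 2) * L ^ (α / 2) := by
      rw [← Real.rpow_add hL0]
      congr 1
      ring
    have hLn : L ^ (α / 2) ≤ (1 + n) ^ (α / 2) :=
      Real.rpow_le_rpow hL0.le hcase.le (by positivity)
    calc _ ≤ ∫⁻ z, ENNReal.ofReal (((1 + Δ) * (1 + n)) ^ δ) *
          ‖multKernel φ (cosMult ℓ L 1 n) x z‖ₑ ∂μ := lintegral_mono hpt
      _ = ENNReal.ofReal (((1 + Δ) * (1 + n)) ^ δ) *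
          ∫⁻ z, ‖multKernel φ (cosMult ℓ L 1 n) x z‖ₑ ∂μ :=
          lintegral_const_mul' _ _ ENNReal.ofReal_ne_top
      _ ≤ ENNReal.ofReal (((1 + Δ) * (1 + n)) ^ δ) *
          ENNReal.ofReal ((κ + 1) * (1 + n) ^ (α / 2)) := by
          gcongr
          refine hall.trans (ENNReal.ofReal_le_ofReal ?_)
          have e : (L ^ (α / 2))⁻¹ * (κ * L ^ α) + (L ^ (α / 2))⁻¹⁻¹ * 1 =
              (κ + 1) * L ^ (α / 2) := by
            rw [hpow]
            field_simp
          rw [e]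
          gcongr
      _ ≤ _ := by
          rw [← ENNReal.ofReal_mul (by positivity), Real.mul_rpow (by positivity) hnp.le]
          refine ENNReal.ofReal_le_ofReal ?_
          rw [hsplit]
          have e : (1 + Δ) ^ δ * (1 + n) ^ δ * ((κ + 1) * (1 + n) ^ (α / 2)) =
              (1 + Δ) ^ δ * (κ + 1) * ((1 + n) ^ (α / 2) * (1 + n) ^ δ) := by ring
          rw [e]
          gcongr
          have : 0 ≤ (1 + A) ^ δ * (κ + c₀ * A ^ α) + κ * C := by positivity
          linarith

end Moment

end IsGaussianSystem

lemma tame_sin_cos {ι : Type*} (k : ℕ) :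
    Tame univ (fun _ => 1) k (fun _ : ι => Real.sin) ∧
      Tame univ (fun _ => 1) k (fun _ : ι => Real.cos) := by
  have hb1 : ∃ (C : ℝ) (m : ℕ), 0 ≤ C ∧ ∀ _i : ι, ∀ x ∈ (univ : Set ℝ),
      |Real.sin x| ≤ C * (fun _ => (1 : ℝ)) x ^ m :=
    ⟨1, 0, zero_le_one, fun _ x _ => by simpa using Real.abs_sin_le_one x⟩
  have hb2 : ∃ (C : ℝ) (m : ℕ), 0 ≤ C ∧ ∀ _i : ι, ∀ x ∈ (univ : Set ℝ),
      |Real.cos x| ≤ C * (fun _ => (1 : ℝ)) x ^ m :=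
    ⟨1, 0, zero_le_one, fun _ x _ => by simpa using Real.abs_cos_le_one x⟩
  induction k with
  | zero => exact ⟨hb1, hb2⟩
  | succ k ih =>
    refine ⟨⟨hb1, _, fun _ x _ => Real.hasDerivAt_sin x, ih.2⟩,
      ⟨hb2, fun _ x => (-1) * Real.sin x, fun _ x _ => ?_,
        Tame.const_mul one_le_one_fun (-1) ih.1⟩⟩
    simpa using Real.hasDerivAt_cos x

/-- A uniformly smooth family of functions on `[0, 1]` has uniformly summable Chebyshev
expansions. -/
lemma Tame.exists_chebyshev_expansion {ι : Type*} {S : ℕ} (hS : 1 ≤ S) {σ : ℝ} (hσ0 : 0 ≤ σ)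
    (hσ : σ < S - 1 / 2) {f : ι → ℝ → ℝ} (hf : Tame univ (fun _ => 1) S f) :
    ∃ B : ℝ, 0 ≤ B ∧ ∃ c : ι → ℤ → ℝ, ∀ i,
      Summable (fun n => |c i n| * (1 + |(n : ℝ)|) ^ σ) ∧
      ∑' n, |c i n| * (1 + |(n : ℝ)|) ^ σ ≤ B ∧
      ∀ x ∈ Icc (0 : ℝ) 1,
        HasSum (fun n : ℤ => c i n * Real.cos (n * Real.arccos (2 * x - 1))) (f i x) := by
  have hv : Tame univ (fun _ => 1) S fun i θ => f i ((1 + Real.cos θ) / 2) := by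
    refine Tame.comp one_le_one_fun hf (v := fun _ θ => (1 + Real.cos θ) / 2)
      (v' := fun _ θ => (-1 / 2) * Real.sin θ) (fun _ θ _ => ?_)
      (Tame.const_mul one_le_one_fun _ (tame_sin_cos S).1)
    refine (((Real.hasDerivAt_cos θ).const_add 1).div_const 2).congr_deriv ?_
    ring
  obtain ⟨B, hB, c, hc⟩ := hv.exists_cos_expansion hS hσ0 hσ
    (fun i θ => by simp only [Real.cos_add_two_pi]) (fun i θ => by simp only [Real.cos_neg])
  refine ⟨B, hB, c, fun i => ⟨(hc i).1, (hc i).2.1, fun x hx => ?_⟩⟩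
  have h1 := (hc i).2.2 (Real.arccos (2 * x - 1))
  rw [Real.cos_arccos (by linarith [hx.1]) (by linarith [hx.2])] at h1
  simpa using h1

namespace IsGaussianSystem

variable {M : Type*} [MetricSpace M] [CompactSpace M] [MeasurableSpace M] [BorelSpace M]
  {μ : Measure M} [IsProbabilityMeasure μ]
  {φ : ℕ → M → ℝ} {ℓ : ℕ → ℝ} {α c₀ κ γ c₁ : ℝ} (h : IsGaussianSystem μ φ ℓ α c₀ κ γ c₁)
include h

/-- The kernel of `X f(X)`, where `X = exp(-(ℓ / L)²)`, is concentrated at scale `1 / L` in a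
weighted `L¹` sense, if `f` has `S > (α + 1) / 2 + δ` bounded derivatives. -/
lemma exists_multiplier_moment {S : ℕ} (hS : 1 ≤ S) {δ : ℝ} (hδ : 0 ≤ δ) (hδ1 : δ ≤ 1)
    (hSδ : α / 2 + δ < S - 1 / 2) {f : ℝ → ℝ → ℝ} (hf : Tame univ (fun _ => 1) S f) :
    ∃ C : ℝ, 0 < C ∧ ∀ L : ℝ, 1 ≤ L → ∀ x : M,
      ∫⁻ z, ‖multKernel φ (fun j => gaussMult ℓ L j * f L (gaussMult ℓ L j)) x z‖ₑ *
        ENNReal.ofReal ((1 + L * dist x z) ^ δ) ∂μ ≤ ENNReal.ofReal C := by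
  obtain ⟨C, hC, hmom⟩ := h.exists_cos_moment hδ hδ1
  have hα := h.alpha_pos
  obtain ⟨B, hB, c, hc⟩ := hf.exists_chebyshev_expansion hS (by positivity) hSδ
  refine ⟨C * (B + 1), by positivity, fun L hL x => ?_⟩
  have hQ := h.isSpectralWeight hL
  obtain ⟨hcs, hcB, hcf⟩ := hc L
  have hcabs : Summable fun n => |c L n| := by
    refine Summable.of_nonneg_of_le (fun n => abs_nonneg _) (fun n => ?_) hcs
    exact le_mul_of_one_le_right (abs_nonneg _)
      (Real.one_le_rpow (by linarith [abs_nonneg (n : ℝ)]) (by positivity))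
  have hcos : ∀ (n : ℤ) (j : ℕ),
      Real.cos (n * Real.arccos (2 * gaussMult ℓ L j - 1)) =
        Real.cos ((n.natAbs : ℕ) * Real.arccos (2 * gaussMult ℓ L j - 1)) := by
    intro n j
    rw [Nat.cast_natAbs, Int.cast_abs]
    rcases abs_choice (n : ℝ) with hn | hn
    · rw [hn]
    · rw [hn, neg_mul, Real.cos_neg]
  have hexp : ∀ z, multKernel φ (fun j => gaussMult ℓ L j * f L (gaussMult ℓ L j)) x z =
      ∑' n : ℤ, c L n * multKernel φ (cosMult ℓ L 1 n.natAbs) x z := by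
    intro z
    have hs1 : Summable fun j => |gaussMult ℓ L j * (φ j x * φ j z)| :=
      hQ.summable_abs (D := 1) (fun j => by
        rw [one_mul, abs_of_pos (gaussMult_pos ℓ L j)]) x z
    have hprod : Summable (Function.uncurry fun (n : ℤ) (j : ℕ) =>
        c L n * (cosMult ℓ L 1 n.natAbs j * (φ j x * φ j z))) := by
      refine Summable.of_norm_bounded (hcabs.mul_of_nonneg hs1 (fun _ => abs_nonneg _)
        fun _ => abs_nonneg _) fun p => ?_
      obtain ⟨n, j⟩ := p
      simp only [Function.uncurry_apply_pair, cosMult, pow_one, norm_mul, Real.norm_eq_abs, abs_mul]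
      have h1 := Real.abs_cos_le_one (n.natAbs * Real.arccos (2 * gaussMult ℓ L j - 1))
      gcongr
      exact mul_le_of_le_one_right (abs_nonneg _) h1
    simp only [multKernel, ← tsum_mul_left]
    rw [← hprod.tsum_comm]
    refine tsum_congr fun j => ?_
    have h2 := (hcf (gaussMult ℓ L j) ⟨(gaussMult_pos ℓ L j).le, gaussMult_le_one ℓ L j⟩).mul_left
      (gaussMult ℓ L j * (φ j x * φ j z))
    rw [mul_right_comm, ← h2.tsum_eq]
    refine tsum_congr fun n => ?_
    simp only [cosMult, hcos n j, pow_one]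
    ring
  calc _ ≤ ∫⁻ z, ∑' n : ℤ, ENNReal.ofReal |c L n| *
          (‖multKernel φ (cosMult ℓ L 1 n.natAbs) x z‖ₑ *
            ENNReal.ofReal ((1 + L * dist x z) ^ δ)) ∂μ := by
        refine lintegral_mono fun z => ?_
        rw [hexp z]
        simp only [← mul_assoc, ENNReal.tsum_mul_right]
        gcongr
        refine enorm_tsum_le_tsum_enorm.trans (le_of_eq (tsum_congr fun n => ?_))
        rw [enorm_mul, Real.enorm_eq_ofReal_abs (c L n)]
    _ = ∑' n : ℤ, ENNReal.ofReal |c L n| *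
          ∫⁻ z, ‖multKernel φ (cosMult ℓ L 1 n.natAbs) x z‖ₑ *
            ENNReal.ofReal ((1 + L * dist x z) ^ δ) ∂μ := by
        have hw : Measurable fun z => ENNReal.ofReal ((1 + L * dist x z) ^ δ) :=
          (((measurable_const.dist measurable_id).const_mul L).const_add
            1 |>.pow_const δ).ennreal_ofReal
        have hmeas : ∀ n : ℤ, AEMeasurable (fun z => ENNReal.ofReal |c L n| *
            (‖multKernel φ (cosMult ℓ L 1 n.natAbs) x z‖ₑ *
              ENNReal.ofReal ((1 + L * dist x z) ^ δ))) μ := fun n =>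
          (((measurable_multKernel h.continuous _ x).enorm.mul hw).const_mul _).aemeasurable
        rw [lintegral_tsum hmeas]
        exact tsum_congr fun n => lintegral_const_mul' _ _ ENNReal.ofReal_ne_top
    _ ≤ ∑' n : ℤ, ENNReal.ofReal (C * (|c L n| * (1 + |(n : ℝ)|) ^ (α / 2 + δ))) := by
        refine ENNReal.tsum_le_tsum fun n => ?_
        refine (mul_le_mul_right (hmom L hL n.natAbs x) _).trans (le_of_eq ?_)
        rw [← ENNReal.ofReal_mul (abs_nonneg _), Nat.cast_natAbs, Int.cast_abs]
        congr 1
        ring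
    _ ≤ _ := by
        rw [← ENNReal.ofReal_tsum_of_nonneg (fun n => by positivity) (hcs.mul_left _),
          tsum_mul_left]
        gcongr
        linarith

end IsGaussianSystem

end Eignet

/-! ### The Schur test and diagonally dominant matrices -/

namespace Eignet

/-- The `ℓ^p` norm of a finite family as an `L^p` norm for the counting measure. -/
lemma ofReal_norm_toLp {ι : Type*} [Fintype ι] [MeasurableSpace ι] [MeasurableSingletonClass ι]
    {p : ℝ≥0∞} (hp : 1 ≤ p) (a : ι → ℝ) :
    ENNReal.ofReal ‖WithLp.toLp p a‖ = eLpNorm a p Measure.count := by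
  have hp0 : p ≠ 0 := (zero_lt_one.trans_le hp).ne'
  by_cases htop : p = ⊤
  · subst htop
    rw [eLpNorm_exponent_top, eLpNormEssSup_count, PiLp.norm_eq_ciSup]
    rcases isEmpty_or_nonempty ι with hι | hι
    · simp
    refine le_antisymm ?_ (iSup_le fun i => ?_)
    · obtain ⟨i, hi⟩ := exists_eq_ciSup_of_finite (f := fun i => ‖(WithLp.toLp ⊤ a).ofLp i‖)
      rw [← hi, ofReal_norm]
      exact le_iSup (fun i => ‖a i‖ₑ) i
    · rw [← ofReal_norm]
      exact ENNReal.ofReal_le_ofReal (le_ciSup (f := fun i => ‖(WithLp.toLp ⊤ a).ofLp i‖)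
        (Finite.bddAbove_range _) i)
  · have hpos : 0 < p.toReal := ENNReal.toReal_pos hp0 htop
    rw [PiLp.norm_eq_sum hpos, eLpNorm_eq_lintegral_rpow_enorm_toReal hp0 htop, lintegral_count,
      tsum_fintype, ← ENNReal.ofReal_rpow_of_nonneg (by positivity) (by positivity),
      ENNReal.ofReal_sum_of_nonneg fun i _ => by positivity]
    congr 1
    refine Finset.sum_congr rfl fun i _ => ?_
    rw [← ENNReal.ofReal_rpow_of_nonneg (norm_nonneg _) hpos.le, ofReal_norm]

/-- Schur's test for an operator from `L^p(ν)` to `ℓ^p` of a finite set. -/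
lemma eLpNorm_count_le_of_schur {ι Y : Type*} [Fintype ι] [MeasurableSpace ι]
    [MeasurableSingletonClass ι] [MeasurableSpace Y] {ν : Measure Y} {p p' : ℝ≥0∞} (hp : 1 ≤ p)
    (hpp' : p.HolderConjugate p') {k : ι → Y → ℝ≥0∞} (hk : ∀ i, Measurable (k i)) {A B : ℝ≥0∞}
    (hAtop : A ≠ ⊤)
    (hcol : ∀ y, ∑ i, k i y ≤ A) (hrow : ∀ i, ∫⁻ y, k i y ∂ν ≤ B)
    {g : Y → ℝ} (hg : AEStronglyMeasurable g ν) {T : ι → ℝ}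
    (hT : ∀ i, ‖T i‖ₑ ≤ ∫⁻ y, k i y * ‖g y‖ₑ ∂ν) :
    eLpNorm T p Measure.count ≤
      B ^ (p'⁻¹).toReal * A ^ (p⁻¹).toReal * eLpNorm g p ν := by
  have hp0 : p ≠ 0 := (zero_lt_one.trans_le hp).ne'
  by_cases htop : p = ⊤
  · subst htop
    have hp' : p' = 1 := (ENNReal.HolderConjugate.eq_top_iff_eq_one ⊤ p').1 rfl
    rw [eLpNorm_exponent_top, eLpNormEssSup_count, hp']
    simp only [inv_one, ENNReal.toReal_one, ENNReal.rpow_one, ENNReal.inv_top, ENNReal.toReal_zero,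
      ENNReal.rpow_zero, mul_one]
    refine iSup_le fun i => (hT i).trans ?_
    calc ∫⁻ y, k i y * ‖g y‖ₑ ∂ν ≤ ∫⁻ y, k i y * eLpNorm g ⊤ ν ∂ν := by
          refine lintegral_mono_ae ?_
          filter_upwards [enorm_ae_le_eLpNormEssSup g ν] with y hy
          gcongr
          simpa using hy
      _ = (∫⁻ y, k i y ∂ν) * eLpNorm g ⊤ ν := lintegral_mul_const _ (hk i)
      _ ≤ B * eLpNorm g ⊤ ν := by gcongr; exact hrow i
  · have hpos : 0 < p.toReal := ENNReal.toReal_pos hp0 htop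
    have hpinv : (p⁻¹).toReal = 1 / p.toReal := by rw [ENNReal.toReal_inv, one_div]
    have hsum : (p⁻¹).toReal + (p'⁻¹).toReal = 1 := by
      have e := hpp'.inv_add_inv_eq_inv
      rw [← ENNReal.toReal_add, e]
      · simp
      · simpa using hp0
      · have : 1 ≤ p' := ENNReal.HolderConjugate.one_le p' p
        simpa using (zero_lt_one.trans_le this).ne'
    set r := p.toReal with hr
    have hr1 : 1 ≤ r := by
      rw [hr, ← ENNReal.toReal_one]
      exact ENNReal.toReal_mono htop hp
    have hp'r : (p'⁻¹).toReal = 1 - 1 / r := by linarith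
    -- Hölder's inequality with respect to the measure with density `k i`.
    have hH : ∀ i, ‖T i‖ₑ ^ r ≤ B ^ (r - 1) * ∫⁻ y, k i y * ‖g y‖ₑ ^ r ∂ν := by
      intro i
      have hr0 : r ≠ 0 := hpos.ne'
      rcases hr1.eq_or_lt with hr1' | hr1'
      · rw [← hr1', sub_self, ENNReal.rpow_zero, one_mul]
        simpa using hT i
      have hconj : (Real.conjExponent r).HolderConjugate r :=
        (Real.HolderConjugate.conjExponent hr1').symm
      have hce : 1 / Real.conjExponent r = 1 - 1 / r := by
        have := hconj.inv_add_inv_eq_one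
        rw [one_div, one_div]
        linarith
      have h1 := ENNReal.lintegral_mul_le_Lp_mul_Lq ν hconj
        (f := fun y => k i y ^ (1 - 1 / r)) (g := fun y => k i y ^ (1 / r) * ‖g y‖ₑ)
        ((hk i).pow_const _).aemeasurable (((hk i).pow_const _).aemeasurable.mul hg.enorm)
      have e1 : ∀ y, ((fun y => k i y ^ (1 - 1 / r)) * fun y => k i y ^ (1 / r) * ‖g y‖ₑ) y =
          k i y * ‖g y‖ₑ := by
        intro y
        have h0 : 0 ≤ 1 - 1 / r := by
          rw [sub_nonneg, div_le_one hpos]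
          exact hr1
        rw [Pi.mul_apply, ← mul_assoc, ← ENNReal.rpow_add_of_nonneg _ _ h0 (by positivity),
          sub_add_cancel, ENNReal.rpow_one]
      have e2 : ∀ y, (k i y ^ (1 - 1 / r)) ^ Real.conjExponent r = k i y := by
        intro y
        rw [← ENNReal.rpow_mul, ← hce, one_div, inv_mul_cancel₀ hconj.ne_zero, ENNReal.rpow_one]
      have e3 : ∀ y, (k i y ^ (1 / r) * ‖g y‖ₑ) ^ r = k i y * ‖g y‖ₑ ^ r := by
        intro y
        rw [ENNReal.mul_rpow_of_nonneg _ _ hpos.le, ← ENNReal.rpow_mul, one_div,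
          inv_mul_cancel₀ hr0, ENNReal.rpow_one]
      simp only [e1, e2, e3, hce] at h1
      calc ‖T i‖ₑ ^ r ≤ ((∫⁻ y, k i y ∂ν) ^ (1 - 1 / r) *
            (∫⁻ y, k i y * ‖g y‖ₑ ^ r ∂ν) ^ (1 / r)) ^ r := by
            gcongr
            exact (hT i).trans h1
        _ = (∫⁻ y, k i y ∂ν) ^ (r - 1) * ∫⁻ y, k i y * ‖g y‖ₑ ^ r ∂ν := by
            rw [ENNReal.mul_rpow_of_nonneg _ _ hpos.le, ← ENNReal.rpow_mul, ← ENNReal.rpow_mul,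
              one_div, inv_mul_cancel₀ hr0, ENNReal.rpow_one, sub_mul, one_mul,
              inv_mul_cancel₀ hr0]
        _ ≤ _ := by
            gcongr
            exact hrow i
    rw [eLpNorm_eq_lintegral_rpow_enorm_toReal hp0 htop,
      eLpNorm_eq_lintegral_rpow_enorm_toReal hp0 htop, lintegral_count, tsum_fintype, ← hr, hpinv,
      hp'r]
    have hmain : ∑ i, ‖T i‖ₑ ^ r ≤ B ^ (r - 1) * (A * ∫⁻ y, ‖g y‖ₑ ^ r ∂ν) := by
      refine (Finset.sum_le_sum fun i _ => hH i).trans ?_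
      have hmeas : ∀ i ∈ Finset.univ, AEMeasurable (fun y => k i y * ‖g y‖ₑ ^ r) ν := fun i _ =>
        (hk i).aemeasurable.mul (hg.enorm.pow_const _)
      rw [← Finset.mul_sum, ← lintegral_finsetSum' _ hmeas, ← lintegral_const_mul' _ _ hAtop]
      gcongr with y
      rw [← Finset.sum_mul]
      gcongr
      exact hcol y
    have hle := ENNReal.rpow_le_rpow hmain (by positivity : 0 ≤ 1 / r)
    refine hle.trans (le_of_eq ?_)
    rw [ENNReal.mul_rpow_of_nonneg _ _ (by positivity),
      ENNReal.mul_rpow_of_nonneg _ _ (by positivity), ← ENNReal.rpow_mul, ← mul_assoc]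
    congr 3
    field_simp

/-- A symmetric matrix whose off-diagonal row sums are at most half of the lower bound `D` of its
diagonal is bounded below by `D / 2` on `ℓ^p`. -/
lemma le_eLpNorm_of_diagonally_dominant {ι : Type*} [Fintype ι] [DecidableEq ι]
    [MeasurableSpace ι] [MeasurableSingletonClass ι] {p p' : ℝ≥0∞} (hp : 1 ≤ p)
    (hpp' : p.HolderConjugate p') {W : ι → ι → ℝ} (hsymm : ∀ i j, W i j = W j i) {D : ℝ}
    (hD : 0 < D) (hdiag : ∀ i, D ≤ W i i)
    (hoff : ∀ i, ∑ j, (if j = i then 0 else |W i j|) ≤ D / 2) (a : ι → ℝ) :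
    ENNReal.ofReal (D / 2) * eLpNorm a p Measure.count ≤
      eLpNorm (fun i => ∑ j, a j * W i j) p Measure.count := by
  have hp0 : p ≠ 0 := (zero_lt_one.trans_le hp).ne'
  set R : ι → ℝ := fun i => ∑ j, if j = i then 0 else a j * W i j with hR
  set T : ι → ℝ := fun i => ∑ j, a j * W i j with hT
  have hsplit : ∀ i, T i = a i * W i i + R i := by
    intro i
    simp only [hT, hR]
    rw [← Finset.add_sum_erase _ _ (Finset.mem_univ i), ← Finset.add_sum_erase _
      (fun j => if j = i then 0 else a j * W i j) (Finset.mem_univ i), if_pos rfl, zero_add]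
    congr 1
    refine Finset.sum_congr rfl fun j hj => ?_
    rw [if_neg (Finset.ne_of_mem_erase hj)]
  have hmeas : ∀ f : ι → ℝ, AEStronglyMeasurable f Measure.count := fun f =>
    (measurable_of_finite f).aestronglyMeasurable
  have hD2 : ENNReal.ofReal (D / 2) ≠ 0 := by simpa using hD
  have hRle : eLpNorm R p Measure.count ≤
      ENNReal.ofReal (D / 2) * eLpNorm a p Measure.count := by
    have hkey : ∀ i, ∑ j, (if j = i then 0 else ENNReal.ofReal |W i j|) ≤
        ENNReal.ofReal (D / 2) := by
      intro i
      refine le_trans (le_of_eq ?_) (ENNReal.ofReal_le_ofReal (hoff i))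
      rw [ENNReal.ofReal_sum_of_nonneg fun j _ => by positivity]
      refine Finset.sum_congr rfl fun j _ => ?_
      split_ifs <;> simp
    have hs := eLpNorm_count_le_of_schur (ν := Measure.count) hp hpp'
      (A := ENNReal.ofReal (D / 2)) (B := ENNReal.ofReal (D / 2))
      (k := fun i j => if j = i then 0 else ENNReal.ofReal |W i j|)
      (fun i => measurable_of_finite _) ENNReal.ofReal_ne_top
      (fun j => ?_) (fun i => ?_) (hmeas a) (T := R) (fun i => ?_)
    · refine hs.trans (le_of_eq ?_)
      rw [← ENNReal.rpow_add _ _ hD2 ENNReal.ofReal_ne_top, ← ENNReal.toReal_add, add_comm,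
        hpp'.inv_add_inv_eq_inv]
      · simp
      · have : 1 ≤ p' := ENNReal.HolderConjugate.one_le p' p
        simpa using (zero_lt_one.trans_le this).ne'
      · simpa using hp0
    · refine le_trans (le_of_eq (Finset.sum_congr rfl fun i _ => ?_)) (hkey j)
      rw [hsymm i j]
      simp only [eq_comm]
    · rw [lintegral_count, tsum_fintype]
      exact hkey i
    · rw [lintegral_count, tsum_fintype]
      refine (enorm_sum_le _ _).trans (Finset.sum_le_sum fun j _ => ?_)
      split_ifs
      · simp
      · rw [enorm_mul, Real.enorm_eq_ofReal_abs (W i j), mul_comm]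
  have hdom : ENNReal.ofReal D * eLpNorm a p Measure.count ≤
      eLpNorm T p Measure.count + eLpNorm R p Measure.count := by
    calc ENNReal.ofReal D * eLpNorm a p Measure.count = eLpNorm (D • a) p Measure.count := by
          rw [eLpNorm_const_smul, Real.enorm_of_nonneg hD.le]
      _ ≤ eLpNorm (T - R) p Measure.count := by
          refine eLpNorm_mono fun i => ?_
          rw [Pi.smul_apply, Pi.sub_apply, hsplit, add_sub_cancel_right, smul_eq_mul, norm_mul,
            norm_mul, Real.norm_of_nonneg hD.le, Real.norm_of_nonneg (hD.le.trans (hdiag i)),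
            mul_comm]
          gcongr
          exact hdiag i
      _ ≤ _ := eLpNorm_sub_le (hmeas T) (hmeas R) hp
  have hafin : eLpNorm a p Measure.count ≠ ⊤ :=
    (eLpNorm_count_lt_top_of_lt fun i => by simp).ne
  have hfin : ENNReal.ofReal (D / 2) * eLpNorm a p Measure.count ≠ ⊤ :=
    ENNReal.mul_ne_top ENNReal.ofReal_ne_top hafin
  refine (ENNReal.add_le_add_iff_right hfin).1 ?_
  calc _ = ENNReal.ofReal D * eLpNorm a p Measure.count := by
        rw [← add_mul, ← ENNReal.ofReal_add (by positivity) (by positivity), add_halves]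
    _ ≤ _ := hdom.trans (by gcongr)

end Eignet

/-! ### The interpolation matrix -/

namespace Eignet

lemma IsMask.exists_lower {S : ℕ} {β : ℝ} {b : ℝ → ℝ} (hb : IsMask S β b) :
    ∃ c : ℝ, 0 < c ∧ ∀ t, 0 < t → c * (1 + t) ^ (-β) ≤ b t := by
  obtain ⟨-, -, F, hF, -, c, hc, hFc⟩ := hb
  refine ⟨c, hc, fun t ht => ?_⟩
  rw [hF t ht, mul_comm]
  exact mul_le_mul_of_nonneg_left (hFc _) (by positivity)

/-- A lower bound for `X ^ a (1 - X) ^ N` by a difference of two powers, from Bernoulli's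
inequality. -/
lemma pow_mul_one_sub_pow_ge {x : ℝ} (hx0 : 0 ≤ x) (hx1 : x ≤ 1) (a N : ℕ) {R : ℕ} (hR : 1 ≤ R) :
    ((R : ℝ) ^ N)⁻¹ * (x ^ a - N * x ^ (a + R)) ≤ x ^ a * (1 - x) ^ N := by
  have hR0 : (0 : ℝ) < R := by exact_mod_cast hR
  have h1 : 1 - x ^ R ≤ R * (1 - x) := by
    have := one_add_mul_le_pow (a := x - 1) (by linarith) R
    rw [add_sub_cancel] at this
    linarith
  have hxR : x ^ R ≤ 1 := pow_le_one₀ hx0 hx1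
  have h2 : 1 - N * x ^ R ≤ (1 - x ^ R) ^ N := by
    have := one_add_mul_le_pow (a := -x ^ R) (by linarith) N
    rw [← sub_eq_add_neg] at this
    linarith
  have h3 : (1 - x ^ R) ^ N ≤ R ^ N * (1 - x) ^ N := by
    rw [← mul_pow]
    exact pow_le_pow_left₀ (by linarith) h1 N
  rw [inv_mul_le_iff₀ (by positivity), pow_add]
  have := mul_le_mul_of_nonneg_left (h2.trans h3) (pow_nonneg hx0 a)
  linarith

namespace IsGaussianSystem

section Pointwise

variable {M : Type*} [MetricSpace M] [MeasurableSpace M] {μ : Measure M}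
  {φ : ℕ → M → ℝ} {ℓ : ℕ → ℝ} {α c₀ κ γ c₁ : ℝ} (h : IsGaussianSystem μ φ ℓ α c₀ κ γ c₁)
include h

lemma abs_bump_kernel_le {L : ℝ} (hL : 1 ≤ L) (N a : ℕ) (ha : 1 ≤ a)
    (haL : ((a + N : ℕ) : ℝ) ≤ L ^ 2) (x y : M) :
    |multKernel φ (fun j => gaussMult ℓ L j ^ a * (1 - gaussMult ℓ L j) ^ N) x y| ≤
      2 ^ N * (κ * L ^ α * Real.exp (-(γ * (L * dist x y) ^ 2 / (a + N : ℕ)))) := by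
  have hL0 : 0 < L := by linarith
  have hQ := h.isSpectralWeight hL
  have hκ := h.kappa_pos
  have hγ := h.gamma_pos
  have hLα : 0 < L ^ α := by positivity
  induction N generalizing a with
  | zero => simpa using h.abs_gauss_pow_le hL0 ha (by simpa using haL) x y
  | succ N ih =>
    have e : (fun j => gaussMult ℓ L j ^ a * (1 - gaussMult ℓ L j) ^ (N + 1)) = fun j =>
        1 * (gaussMult ℓ L j ^ a * (1 - gaussMult ℓ L j) ^ N) +
        (-1) * (gaussMult ℓ L j ^ (a + 1) * (1 - gaussMult ℓ L j) ^ N) := by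
      funext j
      ring
    have hbd : ∀ a, 1 ≤ a → ∀ j, |gaussMult ℓ L j ^ a * (1 - gaussMult ℓ L j) ^ N| ≤
        1 * gaussMult ℓ L j := fun a ha j => by
      refine abs_pow_gaussMult_mul_le ℓ L ha j ?_
      have h0 := gaussMult_pos ℓ L j
      have h1 := gaussMult_le_one ℓ L j
      rw [abs_of_nonneg (pow_nonneg (by linarith) N)]
      exact pow_le_one₀ (by linarith) (by linarith)
    rw [e, hQ.multKernel_add (hbd a ha) (hbd (a + 1) (by omega))]
    have haL' : ((a + N : ℕ) : ℝ) ≤ L ^ 2 := le_trans (by push_cast; linarith) haL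
    have h1 := ih a ha haL'
    have h2 := ih (a + 1) (by omega) (by rwa [show a + 1 + N = a + (N + 1) by omega])
    rw [show a + 1 + N = a + (N + 1) by omega] at h2
    have haN : (0 : ℝ) < (a + N : ℕ) := by exact_mod_cast (by omega)
    have h3 : 2 ^ N * (κ * L ^ α * Real.exp (-(γ * (L * dist x y) ^ 2 / (a + N : ℕ)))) ≤
        2 ^ N * (κ * L ^ α * Real.exp (-(γ * (L * dist x y) ^ 2 / (a + (N + 1) : ℕ)))) := by
      gcongr
      omega
    rw [pow_succ]
    rw [abs_le] at h1 h2 ⊢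
    constructor <;> linarith

lemma exists_bump_kernel_le (N : ℕ) :
    ∃ C : ℝ, 0 < C ∧ ∀ L : ℝ, 1 ≤ L → ((N + 2 + N : ℕ) : ℝ) ≤ L ^ 2 → ∀ x y : M,
      |multKernel φ (fun j => gaussMult ℓ L j ^ (N + 2) * (1 - gaussMult ℓ L j) ^ N) x y| ≤
        C * L ^ α * Real.exp (-(L * dist x y)) := by
  have hκ := h.kappa_pos
  have hγ := h.gamma_pos
  refine ⟨2 ^ N * κ * Real.exp (1 ^ 2 / (4 * (γ / (N + 2 + N : ℕ)))), by positivity,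
    fun L hL hNL x y => ?_⟩
  have hLα : 0 < L ^ α := Real.rpow_pos_of_pos (by linarith) _
  refine (h.abs_bump_kernel_le hL N (N + 2) (by omega) hNL x y).trans ?_
  have h1 := exp_neg_sq_le (g := γ / (N + 2 + N : ℕ)) (s := L * dist x y) (a := 1) (by positivity)
  rw [one_mul, div_mul_eq_mul_div] at h1
  calc _ ≤ 2 ^ N * (κ * L ^ α * (Real.exp (1 ^ 2 / (4 * (γ / (N + 2 + N : ℕ)))) *
        Real.exp (-(L * dist x y)))) := by gcongr
    _ = _ := by ring

/-- The lower bound for the diagonal: the spectral measure of `x` gives mass of order `L ^ α` to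
frequencies comparable to `L`, as a comparison of the heat kernel at two times of order `L⁻²`
shows. -/
lemma exists_diag_lower {S : ℕ} {β : ℝ} (hβ : 0 < β) {b : ℝ → ℝ} (hb : IsMask S β b) {N : ℕ}
    (hN : 1 ≤ N) {f : ℝ → ℝ → ℝ} {D : ℝ} (hfD : ∀ L x, |f L x| ≤ D)
    (hid : ∀ L, 0 < L → ∀ j, (gaussMult ℓ L j * (1 - gaussMult ℓ L j)) ^ N * b (ℓ j) =
      L ^ (-β) * f L (gaussMult ℓ L j)) :
    ∃ c L₀ : ℝ, 0 < c ∧ 1 ≤ L₀ ∧ ∀ L, L₀ ≤ L → ∀ x : M,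
      c * L ^ α ≤ multKernel φ (fun j => gaussMult ℓ L j ^ 2 * f L (gaussMult ℓ L j)) x x := by
  obtain ⟨cF, hcF, hbF⟩ := hb.exists_lower
  have hκ := h.kappa_pos
  have hc₁ := h.low_pos
  have hα := h.alpha_pos
  have hN0 : (0 : ℝ) < N := by exact_mod_cast hN
  set P : ℝ := c₁ * ((N + 3 : ℕ) : ℝ) ^ (-α / 2) with hP
  have hPpos : 0 < P := by positivity
  -- The second heat kernel is taken at so large a time that it is negligible on the diagonal.
  obtain ⟨R, hR1, hR⟩ : ∃ R : ℕ, 1 ≤ R ∧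
      N * (κ * ((N + 3 + R : ℕ) : ℝ) ^ (-α / 2)) ≤ P / 2 := by
    have ht : Tendsto (fun R : ℕ => N * (κ * ((N + 3 + R : ℕ) : ℝ) ^ (-α / 2))) atTop
        (𝓝 (N * (κ * 0))) := by
      refine Tendsto.const_mul _ (Tendsto.const_mul _ ?_)
      have h1 : Tendsto (fun R : ℕ => ((N + 3 + R : ℕ) : ℝ)) atTop atTop :=
        tendsto_natCast_atTop_atTop.comp (tendsto_add_atTop_nat (N + 3) |>.congr fun R => by
          rw [add_comm])
      have h2 := (tendsto_rpow_neg_atTop (half_pos hα)).comp h1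
      refine h2.congr fun R => ?_
      simp only [Function.comp_apply]
      congr 1
      ring
    rw [mul_zero, mul_zero] at ht
    have hev := (ht.eventually (ge_mem_nhds (half_pos hPpos))).and (eventually_ge_atTop 1)
    obtain ⟨R, hR⟩ := hev.exists
    exact ⟨R, hR.2, hR.1⟩
  have hR0 : (0 : ℝ) < R := by exact_mod_cast hR1
  set c' : ℝ := cF * Real.exp (-(β ^ 2 / 4)) * ((R : ℝ) ^ N)⁻¹ with hc'
  have hc'pos : 0 < c' := by positivity
  refine ⟨c' * (P / 2), (N + 3 + R : ℕ), by positivity, by exact_mod_cast (by omega),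
    fun L hL x => ?_⟩
  have hNR1 : (1 : ℝ) ≤ (N + 3 + R : ℕ) := by exact_mod_cast (by omega)
  have hL1 : 1 ≤ L := hNR1.trans hL
  have hL0 : 0 < L := by linarith
  have hLα : 0 < L ^ α := by positivity
  have hLL : L ≤ L ^ 2 := by nlinarith
  have hk2 : ((N + 3 + R : ℕ) : ℝ) ≤ L ^ 2 := hL.trans hLL
  have hk1 : ((N + 3 : ℕ) : ℝ) ≤ L ^ 2 := le_trans (by push_cast; linarith) hk2
  have hQ := h.isSpectralWeight hL1
  have hXp : ∀ k, 1 ≤ k → ∀ j, |gaussMult ℓ L j ^ k| ≤ 1 * gaussMult ℓ L j := fun k hk j => by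
    simpa using abs_pow_gaussMult_mul_le ℓ L hk j (r := 1) (D := 1) (by simp)
  have hterm : ∀ j, c' * gaussMult ℓ L j ^ (N + 3) +
      (-(c' * N)) * gaussMult ℓ L j ^ (N + 3 + R) ≤
      gaussMult ℓ L j ^ 2 * f L (gaussMult ℓ L j) := by
    intro j
    set X := gaussMult ℓ L j with hX
    have hX0 : 0 < X := gaussMult_pos ℓ L j
    have hX1 : X ≤ 1 := gaussMult_le_one ℓ L j
    have hf : f L X = L ^ β * ((X * (1 - X)) ^ N * b (ℓ j)) := by
      rw [hX, hid L hL0 j, ← mul_assoc, ← Real.rpow_add hL0, add_neg_cancel, Real.rpow_zero,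
        one_mul]
    rcases (h.ell_nonneg j).eq_or_lt with hj | hj
    · have hX1' : X = 1 := by simp [hX, gaussMult, ← hj]
      have hN1 : (1 : ℝ) ≤ N := by exact_mod_cast hN
      rw [hf, hX1', sub_self, mul_zero, zero_pow (by omega)]
      simp only [one_pow]
      nlinarith
    · set u := ℓ j / L with hu
      have hu0 : 0 < u := by positivity
      have hbl : cF * Real.exp (-(β ^ 2 / 4)) * X ≤ L ^ β * b (ℓ j) := by
        have h1 : 1 + ℓ j ≤ L * Real.exp u := by
          have e1 := Real.add_one_le_exp u
          have e2 : ℓ j = L * u := by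
            rw [hu]
            field_simp
          nlinarith
        have h2 : L ^ (-β) * Real.exp (-(β * u)) ≤ (1 + ℓ j) ^ (-β) := by
          have e1 : Real.exp (-(β * u)) = Real.exp u ^ (-β) := by
            rw [← Real.exp_mul]
            congr 1
            ring
          rw [e1, ← Real.mul_rpow hL0.le (Real.exp_pos _).le]
          exact Real.rpow_le_rpow_of_nonpos (by positivity) h1 (by linarith)
        have h3 : Real.exp (-(β ^ 2 / 4)) * X ≤ Real.exp (-(β * u)) := by
          rw [hX, gaussMult, ← hu, ← Real.exp_add]
          exact Real.exp_le_exp.2 (by nlinarith [sq_nonneg (u - β / 2)])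
        have h4 := hbF (ℓ j) hj
        have h5 : L ^ β * L ^ (-β) = 1 := by
          rw [← Real.rpow_add hL0, add_neg_cancel, Real.rpow_zero]
        calc cF * Real.exp (-(β ^ 2 / 4)) * X = cF * (Real.exp (-(β ^ 2 / 4)) * X) := by ring
          _ ≤ cF * Real.exp (-(β * u)) := by gcongr
          _ = L ^ β * (cF * (L ^ (-β) * Real.exp (-(β * u)))) := by
              linear_combination (-(cF * Real.exp (-(β * u)))) * h5
          _ ≤ L ^ β * b (ℓ j) := by
              gcongr
              exact le_trans (by gcongr) h4
      have hpow := pow_mul_one_sub_pow_ge hX0.le hX1 (N + 3) N hR1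
      have h1X : 0 ≤ 1 - X := by linarith
      calc c' * X ^ (N + 3) + (-(c' * N)) * X ^ (N + 3 + R)
          = cF * Real.exp (-(β ^ 2 / 4)) *
            (((R : ℝ) ^ N)⁻¹ * (X ^ (N + 3) - N * X ^ (N + 3 + R))) := by
            rw [hc']
            ring
        _ ≤ cF * Real.exp (-(β ^ 2 / 4)) * (X ^ (N + 3) * (1 - X) ^ N) := by gcongr
        _ = X ^ (N + 2) * (1 - X) ^ N * (cF * Real.exp (-(β ^ 2 / 4)) * X) := by ring
        _ ≤ X ^ (N + 2) * (1 - X) ^ N * (L ^ β * b (ℓ j)) := by gcongr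
        _ = X ^ 2 * f L X := by
            rw [hf, mul_pow]
            ring
  have hlow := hQ.multKernel_self_mono (D₁ := c' + c' * N) (D₂ := D) (fun j => ?_)
    (fun j => abs_pow_gaussMult_mul_le ℓ L (by norm_num) j (hfD L _)) hterm x
  · refine le_trans ?_ hlow
    rw [hQ.multKernel_add (hXp _ (by omega)) (hXp _ (by omega))]
    have h1 := h.le_gauss_pow_self hL0 (by omega : 1 ≤ N + 3) hk1 x
    have h2 := h.gauss_pow_self_le hL0 (by omega : 1 ≤ N + 3 + R) hk2 x
    have h3 := mul_le_mul_of_nonneg_left h1 hc'pos.le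
    have h4 := mul_le_mul_of_nonneg_left h2 (by positivity : 0 ≤ c' * N)
    have h5 := mul_le_mul_of_nonneg_left hR (by positivity : 0 ≤ c' * L ^ α)
    have e1 : c' * (c₁ * (((N + 3 : ℕ) : ℝ) ^ (-α / 2) * L ^ α)) = c' * L ^ α * P := by
      rw [hP]
      ring
    rw [e1] at h3
    nlinarith
  · clear_value c'
    have h1 := hXp (N + 3) (by omega) j
    have h2 := hXp (N + 3 + R) (by omega) j
    refine (abs_add_le _ _).trans ?_
    rw [abs_mul, abs_mul, abs_neg, abs_of_pos hc'pos, abs_of_pos (by positivity : 0 < c' * N)]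
    have h3 := mul_le_mul_of_nonneg_left h1 hc'pos.le
    have h4 := mul_le_mul_of_nonneg_left h2 (by positivity : 0 ≤ c' * N)
    linarith

end Pointwise

section OffDiagonal

variable {M : Type*} [MetricSpace M] [CompactSpace M] [MeasurableSpace M] [BorelSpace M]
  {μ : Measure M} [IsProbabilityMeasure μ]
  {φ : ℕ → M → ℝ} {ℓ : ℕ → ℝ} {α c₀ κ γ c₁ : ℝ} (h : IsGaussianSystem μ φ ℓ α c₀ κ γ c₁)
include h

/-- Off-diagonal sums over a `q`-separated set are small relative to `L ^ α` once `L q` is large.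
The kernel is written as the composition of the kernel of `X f(X)` with the heat kernel: either
the intermediate point is far from `x`, where the first factor has little mass, or it is far from
every other point of the set, where the second factor is exponentially small. -/
lemma exists_off_diagonal_le [DecidableEq M] {S : ℕ} (hS : α < S) {f : ℝ → ℝ → ℝ}
    (hf : Tame univ (fun _ => 1) S f) {ε : ℝ} (hε : 0 < ε) :
    ∃ K : ℝ, 0 < K ∧ ∀ L : ℝ, 1 ≤ L → ∀ (q : ℝ) (A : Finset M),
      (∀ x ∈ A, ∀ y ∈ A, x ≠ y → q ≤ dist x y) → K ≤ L * q → ∀ x ∈ A,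
      ∑ y ∈ A, (if y = x then 0 else
        |multKernel φ (fun j => gaussMult ℓ L j ^ 2 * f L (gaussMult ℓ L j)) x y|) ≤
        ε * L ^ α := by
  have hα := h.alpha_pos
  have hκ := h.kappa_pos
  have hγ := h.gamma_pos
  have hS1 : 1 ≤ S := by
    have : (0 : ℝ) < S := hα.trans hS
    exact_mod_cast this
  have hS1' : (1 : ℝ) ≤ S := by exact_mod_cast hS1
  obtain ⟨D, m, hD, hfb⟩ := hf.bound
  have hfD : ∀ L x, |f L x| ≤ D := fun L x => by simpa using hfb L x (mem_univ x)
  set δ : ℝ := min 1 ((S - 1 / 2 - α / 2) / 2) with hδ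
  have hgap : 0 < (S - 1 / 2 - α / 2) / 2 := by linarith
  have hδ0 : 0 < δ := lt_min one_pos hgap
  have hδ1 : δ ≤ 1 := min_le_left _ _
  have hδS : α / 2 + δ < S - 1 / 2 := by
    have : δ ≤ (S - 1 / 2 - α / 2) / 2 := min_le_right _ _
    linarith
  obtain ⟨C₁, hC₁, hmom⟩ := h.exists_multiplier_moment hS1 hδ0.le hδ1 hδS hf
  obtain ⟨C₂, K₂, hC₂, hK₂, hsum⟩ := h.exists_sum_exp_le
  set κ' : ℝ := κ * Real.exp (2 ^ 2 / (4 * γ)) with hκ'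
  have hκ'pos : 0 < κ' := by positivity
  obtain ⟨T, hT1, hT⟩ : ∃ T : ℝ, 1 ≤ T ∧ κ' * C₂ * C₁ * T ^ (-δ) ≤ ε := by
    have ht := (tendsto_rpow_neg_atTop hδ0).const_mul (κ' * C₂ * C₁)
    rw [mul_zero] at ht
    have hev := (ht.eventually (ge_mem_nhds hε)).and (eventually_ge_atTop 1)
    obtain ⟨T, hT⟩ := hev.exists
    exact ⟨T, hT.2, hT.1⟩
  refine ⟨max K₂ (2 * T), lt_max_of_lt_left hK₂, fun L hL q A hsep hK x hx => ?_⟩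
  have hL0 : 0 < L := by linarith
  have hLα : 0 < L ^ α := by positivity
  have hT0 : 0 < T := by linarith
  have hKT : 2 * T ≤ L * q := (le_max_right _ _).trans hK
  have hKS := hsum L hL q A hsep ((le_max_left _ _).trans hK)
  have hQ := h.isSpectralWeight hL
  have hone : ((1 : ℕ) : ℝ) ≤ L ^ 2 := by simpa using one_le_pow₀ hL (n := 2)
  have hheat : ∀ z y, |multKernel φ (gaussMult ℓ L) z y| ≤
      κ' * L ^ α * Real.exp (-(2 * (L * dist z y))) := by
    intro z y
    have h1 := h.abs_gauss_pow_le hL0 le_rfl hone z y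
    simp only [pow_one, Nat.cast_one, div_one] at h1
    refine h1.trans ?_
    have h2 := exp_neg_sq_le (g := γ) (s := L * dist z y) (a := 2) hγ
    calc κ * L ^ α * Real.exp (-(γ * (L * dist z y) ^ 2))
        ≤ κ * L ^ α * (Real.exp (2 ^ 2 / (4 * γ)) * Real.exp (-(2 * (L * dist z y)))) := by gcongr
      _ = _ := by
          rw [hκ']
          ring
  have hexpT : Real.exp (-T) ≤ T ^ (-δ) := by
    rw [Real.exp_neg, Real.rpow_neg hT0.le]
    refine inv_anti₀ (by positivity) ?_
    calc T ^ δ ≤ T ^ (1 : ℝ) := Real.rpow_le_rpow_of_exponent_le hT1 hδ1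
      _ = T := Real.rpow_one T
      _ ≤ Real.exp T := by linarith [Real.add_one_le_exp T]
  have hrow : ∀ z, ∑ y ∈ A, (if y = x then 0 else |multKernel φ (gaussMult ℓ L) z y|) ≤
      κ' * C₂ * T ^ (-δ) * L ^ α * (1 + L * dist x z) ^ δ := by
    intro z
    have hd0 : 0 ≤ L * dist x z := by positivity
    have hbound : ∀ y ∈ A, (if y = x then 0 else |multKernel φ (gaussMult ℓ L) z y|) ≤
        κ' * L ^ α * (T ^ (-δ) * (1 + L * dist x z) ^ δ) * Real.exp (-(L * dist z y)) := by
      intro y hy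
      by_cases hyx : y = x
      · rw [if_pos hyx]
        positivity
      rw [if_neg hyx]
      refine (hheat z y).trans ?_
      have hd : 0 ≤ L * dist z y := by positivity
      rw [mul_assoc (κ' * L ^ α)]
      gcongr
      rcases le_total (L * dist x z) T with hz | hz
      · have h1 : T ≤ L * dist z y := by
          have h2 : q ≤ dist x z + dist z y :=
            (hsep x hx y hy (Ne.symm hyx)).trans (dist_triangle x z y)
          have h3 : L * q ≤ L * dist x z + L * dist z y := by nlinarith
          linarith
        have h2 : Real.exp (-(2 * (L * dist z y))) ≤
            Real.exp (-T) * Real.exp (-(L * dist z y)) := by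
          rw [← Real.exp_add]
          exact Real.exp_le_exp.2 (by linarith)
        refine h2.trans ?_
        gcongr
        refine hexpT.trans (le_mul_of_one_le_right (by positivity) ?_)
        exact Real.one_le_rpow (by linarith) hδ0.le
      · have h1 : 1 ≤ T ^ (-δ) * (1 + L * dist x z) ^ δ := by
          rw [Real.rpow_neg hT0.le, ← div_eq_inv_mul, one_le_div (by positivity)]
          exact Real.rpow_le_rpow hT0.le (by linarith) hδ0.le
        have h2 : Real.exp (-(2 * (L * dist z y))) ≤ Real.exp (-(L * dist z y)) :=
          Real.exp_le_exp.2 (by linarith)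
        exact h2.trans (le_mul_of_one_le_left (Real.exp_pos _).le h1)
    refine (Finset.sum_le_sum hbound).trans ?_
    rw [← Finset.mul_sum]
    calc _ ≤ κ' * L ^ α * (T ^ (-δ) * (1 + L * dist x z) ^ δ) * C₂ := by
          gcongr
          exact hKS z
      _ = _ := by ring
  set V : M → ℝ := multKernel φ (fun j => gaussMult ℓ L j * f L (gaussMult ℓ L j)) x with hV
  have hfac : ∀ y, multKernel φ (fun j => gaussMult ℓ L j ^ 2 * f L (gaussMult ℓ L j)) x y =
      ∫ z, V z * multKernel φ (gaussMult ℓ L) z y ∂μ := by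
    intro y
    rw [hV, hQ.integral_multKernel_mul h.continuous h.orthonormal (D₁ := D) (D₂ := 1)
      (fun j => by simpa using abs_pow_gaussMult_mul_le ℓ L le_rfl j (hfD L _)) hD
      (fun j => by rw [one_mul, abs_of_pos (gaussMult_pos ℓ L j)]) zero_le_one]
    congr 1
    funext j
    ring
  have hmeasK : ∀ y, Measurable fun z => multKernel φ (gaussMult ℓ L) z y := fun y => by
    simp only [multKernel_comm (φ := φ) _ _ y]
    exact measurable_multKernel h.continuous _ y
  have hVm : Measurable V := measurable_multKernel h.continuous _ x
  have hle : ENNReal.ofReal (∑ y ∈ A, (if y = x then 0 else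
        |multKernel φ (fun j => gaussMult ℓ L j ^ 2 * f L (gaussMult ℓ L j)) x y|)) ≤
      ENNReal.ofReal (ε * L ^ α) := by
    rw [ENNReal.ofReal_sum_of_nonneg fun y _ => by positivity]
    calc _ ≤ ∑ y ∈ A, ∫⁻ z, ‖V z‖ₑ * ENNReal.ofReal
            (if y = x then 0 else |multKernel φ (gaussMult ℓ L) z y|) ∂μ := by
          refine Finset.sum_le_sum fun y _ => ?_
          by_cases hyx : y = x
          · simp [hyx]
          · simp only [if_neg hyx]
            rw [hfac, ← Real.enorm_eq_ofReal_abs]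
            refine (enorm_integral_le_lintegral_enorm _).trans (le_of_eq ?_)
            refine lintegral_congr fun z => ?_
            rw [enorm_mul, Real.enorm_eq_ofReal_abs (multKernel φ (gaussMult ℓ L) z y)]
      _ = ∫⁻ z, ‖V z‖ₑ * ENNReal.ofReal
            (∑ y ∈ A, if y = x then 0 else |multKernel φ (gaussMult ℓ L) z y|) ∂μ := by
          rw [← lintegral_finsetSum]
          · refine lintegral_congr fun z => ?_
            rw [ENNReal.ofReal_sum_of_nonneg fun y _ => by positivity, Finset.mul_sum]
          · intro y _
            refine hVm.enorm.mul (Measurable.ennreal_ofReal ?_)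
            by_cases hyx : y = x
            · simp [hyx]
            · simpa only [if_neg hyx] using (hmeasK y).abs
      _ ≤ ∫⁻ z, ENNReal.ofReal (κ' * C₂ * T ^ (-δ) * L ^ α) *
            (‖V z‖ₑ * ENNReal.ofReal ((1 + L * dist x z) ^ δ)) ∂μ := by
          refine lintegral_mono fun z => ?_
          rw [mul_left_comm, ← ENNReal.ofReal_mul (by positivity)]
          gcongr
          exact hrow z
      _ ≤ ENNReal.ofReal (κ' * C₂ * T ^ (-δ) * L ^ α) * ENNReal.ofReal C₁ := by
          rw [lintegral_const_mul' _ _ ENNReal.ofReal_ne_top]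
          gcongr
          exact hmom L hL x
      _ ≤ _ := by
          rw [← ENNReal.ofReal_mul (by positivity)]
          refine ENNReal.ofReal_le_ofReal ?_
          calc κ' * C₂ * T ^ (-δ) * L ^ α * C₁ = κ' * C₂ * C₁ * T ^ (-δ) * L ^ α := by ring
            _ ≤ ε * L ^ α := by gcongr
  exact (ENNReal.ofReal_le_ofReal_iff (by positivity)).1 hle

end OffDiagonal

end IsGaussianSystem

end Eignet

/-! ### The coefficient inequality -/

namespace Eignet

lemma integrable_eignet {M : Type*} [MeasurableSpace M] {μ : Measure M} {φ : ℕ → M → ℝ}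
    {ℓ : ℕ → ℝ} {b : ℝ → ℝ} {G : M → M → ℝ} (hG : HasEigExpansion μ φ ℓ b G) (C : Finset M)
    (a : C → ℝ) : Integrable (eignet G C a) μ :=
  integrable_finsetSum _ fun y _ => (hG y).1.const_mul (a y)

/-- An operator with multiplier `m` maps an eignet with mask `b` to the combination of the columns
of the kernel with multiplier `m b`. -/
lemma IsSpectralWeight.integral_mul_eignet {M : Type*} [TopologicalSpace M] [MeasurableSpace M]
    [BorelSpace M] {μ : Measure M} {φ : ℕ → M → ℝ} {ℓ Q : ℕ → ℝ} {B D : ℝ} {m : ℕ → ℝ} {b : ℝ → ℝ}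
    {G : M → M → ℝ} (hQ : IsSpectralWeight φ Q B) (hφ : ∀ j, Continuous (φ j))
    (hm : ∀ j, |m j| ≤ D * Q j) (hD : 0 ≤ D) (hG : HasEigExpansion μ φ ℓ b G) (C : Finset M)
    (a : C → ℝ) (x : M) :
    ∫ z, multKernel φ m x z * eignet G C a z ∂μ =
      ∑ y : C, a y * multKernel φ (fun j => m j * b (ℓ j)) x y := by
  have hint : ∀ y, Integrable (fun z => multKernel φ m x z * G z y) μ := fun y =>
    (hG y).1.bdd_mul (measurable_multKernel hφ m x).aestronglyMeasurable
      (ae_of_all _ fun z => hQ.abs_multKernel_le hm hD x z)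
  have hone : ∀ y, ∫ z, multKernel φ m x z * G z y ∂μ =
      multKernel φ (fun j => m j * b (ℓ j)) x y := by
    intro y
    rw [← (hQ.hasSum_integral hφ hm hD (hG y).1 x).tsum_eq, multKernel]
    refine tsum_congr fun j => ?_
    rw [(hG y).2 j]
    ring
  have e : ∀ z, multKernel φ m x z * eignet G C a z =
      ∑ y : C, a y * (multKernel φ m x z * G z y) := by
    intro z
    rw [eignet, Finset.mul_sum]
    exact Finset.sum_congr rfl fun y _ => by ring
  simp only [e]
  rw [integral_finsetSum _ fun (y : C) _ => (hint y).const_mul (a y)]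
  refine Finset.sum_congr rfl fun y _ => ?_
  rw [integral_const_mul, hone]

section

variable {M : Type*} [MetricSpace M] [CompactSpace M] [MeasurableSpace M] [BorelSpace M]
  {μ : Measure M} [IsProbabilityMeasure μ]
  {φ : ℕ → M → ℝ} {ℓ : ℕ → ℝ} {α c₀ κ γ c₁ : ℝ}

variable (h : IsGaussianSystem μ φ ℓ α c₀ κ γ c₁)
include h

/-- Sampling on a separated set, after smoothing at scale `1 / L` with a multiplier that also
suppresses the frequencies far below `L`, is bounded from `L^p` to `ℓ^p`. -/
lemma IsGaussianSystem.exists_sampling_bound (N : ℕ) {p p' : ℝ≥0∞} (hp : 1 ≤ p)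
    (hpp' : p.HolderConjugate p') :
    ∃ E K : ℝ, 0 < E ∧ 0 < K ∧ ∀ L : ℝ, 1 ≤ L → ((N + 2 + N : ℕ) : ℝ) ≤ L ^ 2 →
      ∀ (q : ℝ) (C : Finset M), (∀ x ∈ C, ∀ y ∈ C, x ≠ y → q ≤ dist x y) → K ≤ L * q →
      ∀ g : M → ℝ, AEStronglyMeasurable g μ →
      eLpNorm (fun x : C => ∫ z, multKernel φ (fun j => gaussMult ℓ L j ^ (N + 2) *
        (1 - gaussMult ℓ L j) ^ N) x z * g z ∂μ) p Measure.count ≤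
      ENNReal.ofReal (E * L ^ (α * (p⁻¹).toReal)) * eLpNorm g p μ := by
  obtain ⟨C₁, hC₁, hker⟩ := h.exists_bump_kernel_le N
  obtain ⟨C₂, hC₂, hint⟩ := h.exists_lintegral_exp_le
  obtain ⟨C₃, K, hC₃, hK, hsum⟩ := h.exists_sum_exp_le
  have hp0 : p ≠ 0 := (zero_lt_one.trans_le hp).ne'
  have hsum1 : (p'⁻¹).toReal + (p⁻¹).toReal = 1 := by
    have e := hpp'.inv_add_inv_eq_inv
    rw [add_comm, ← ENNReal.toReal_add, e]
    · simp
    · simpa using hp0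
    · have : 1 ≤ p' := ENNReal.HolderConjugate.one_le p' p
      simpa using (zero_lt_one.trans_le this).ne'
  set E : ℝ := max (C₁ * C₂) (C₁ * C₃) with hE
  have hE0 : 0 < E := lt_max_of_lt_left (by positivity)
  refine ⟨E, K, hE0, hK, fun L hL hNL q C hsep hKL g hg => ?_⟩
  have hL0 : 0 < L := by linarith
  have hLα : 0 < L ^ α := by positivity
  set m : ℕ → ℝ := fun j => gaussMult ℓ L j ^ (N + 2) * (1 - gaussMult ℓ L j) ^ N with hm
  have hker' : ∀ x z, ‖multKernel φ m x z‖ₑ ≤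
      ENNReal.ofReal (C₁ * L ^ α) * ENNReal.ofReal (Real.exp (-(L * dist x z))) := by
    intro x z
    rw [Real.enorm_eq_ofReal_abs, ← ENNReal.ofReal_mul (by positivity)]
    exact ENNReal.ofReal_le_ofReal (hker L hL hNL x z)
  have hs := eLpNorm_count_le_of_schur (ι := C) (ν := μ) hp hpp'
    (k := fun x z => ‖multKernel φ m x z‖ₑ) (A := ENNReal.ofReal (E * L ^ α))
    (B := ENNReal.ofReal E) (fun x => (measurable_multKernel h.continuous m x).enorm)
    ENNReal.ofReal_ne_top (fun z => ?_) (fun x => ?_) hg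
    (T := fun x : C => ∫ z, multKernel φ m x z * g z ∂μ) (fun x => ?_)
  · refine hs.trans (le_of_eq ?_)
    congr 1
    rw [ENNReal.ofReal_rpow_of_pos hE0, ENNReal.ofReal_rpow_of_pos (by positivity),
      ← ENNReal.ofReal_mul (by positivity), Real.mul_rpow hE0.le hLα.le, ← mul_assoc,
      ← Real.rpow_add hE0, hsum1, Real.rpow_one, ← Real.rpow_mul hL0.le]
  · calc ∑ x : C, ‖multKernel φ m x z‖ₑ
        ≤ ∑ x : C, ENNReal.ofReal (C₁ * L ^ α * Real.exp (-(L * dist z x))) := by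
          refine Finset.sum_le_sum fun x _ => (hker' x z).trans (le_of_eq ?_)
          rw [← ENNReal.ofReal_mul (by positivity), dist_comm]
      _ = ENNReal.ofReal (C₁ * L ^ α * ∑ x ∈ C, Real.exp (-(L * dist z x))) := by
          rw [← ENNReal.ofReal_sum_of_nonneg fun x _ => by positivity, ← Finset.mul_sum,
            Finset.sum_coe_sort C fun x => Real.exp (-(L * dist z x))]
      _ ≤ ENNReal.ofReal (E * L ^ α) := by
          refine ENNReal.ofReal_le_ofReal ?_
          calc _ ≤ C₁ * L ^ α * C₃ := by
                gcongr
                exact hsum L hL q C hsep hKL z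
            _ = C₁ * C₃ * L ^ α := by ring
            _ ≤ E * L ^ α := by
                gcongr
                exact le_max_right _ _
  · calc ∫⁻ z, ‖multKernel φ m x z‖ₑ ∂μ
        ≤ ∫⁻ z, ENNReal.ofReal (C₁ * L ^ α) *
            ENNReal.ofReal (Real.exp (-(L * dist (x : M) z))) ∂μ :=
          lintegral_mono fun z => hker' x z
      _ ≤ ENNReal.ofReal (C₁ * L ^ α) * ENNReal.ofReal (C₂ * L ^ (-α)) := by
          rw [lintegral_const_mul' _ _ ENNReal.ofReal_ne_top]
          gcongr
          exact hint L hL0 x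
      _ ≤ ENNReal.ofReal E := by
          rw [← ENNReal.ofReal_mul (by positivity)]
          refine ENNReal.ofReal_le_ofReal (le_trans (le_of_eq ?_) (le_max_left _ _))
          rw [Real.rpow_neg hL0.le]
          field_simp
  · refine (enorm_integral_le_lintegral_enorm _).trans (le_of_eq ?_)
    exact lintegral_congr fun z => enorm_mul _ _

/-- The coefficient inequality for a system with Gaussian heat kernel bounds on a compact metric
space. -/
theorem IsGaussianSystem.exists_coefficient_bound {S : ℕ} (hS : α < S) {p p' : ℝ≥0∞} (hp : 1 ≤ p)
    (hpp' : p.HolderConjugate p') {β : ℝ} (hβ : 0 < β) {b : ℝ → ℝ} (hb : IsMask S β b)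
    {G : M → M → ℝ} (hG : HasEigExpansion μ φ ℓ b G) :
    ∃ c : ℝ, 0 < c ∧ ∀ C : Finset M, C.Nontrivial → ∀ a : C → ℝ,
      ENNReal.ofReal ‖WithLp.toLp p a‖ ≤
        ENNReal.ofReal (c * (C : Set M).infsep ^ (α * (p'⁻¹).toReal - β)) *
          eLpNorm (eignet G C a) p μ := by
  classical
  have hα := h.alpha_pos
  obtain ⟨N, f, hN, hf, hid⟩ := hb.exists_profile hβ
  obtain ⟨D, k, hD, hfb⟩ := hf.bound
  have hfD : ∀ L x, |f L x| ≤ D := fun L x => by simpa using hfb L x (mem_univ x)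
  have hid' : ∀ L, 0 < L → ∀ j, (gaussMult ℓ L j * (1 - gaussMult ℓ L j)) ^ N * b (ℓ j) =
      L ^ (-β) * f L (gaussMult ℓ L j) := by
    intro L hL j
    have e := hid L hL (ℓ j / L) (div_nonneg (h.ell_nonneg j) hL.le)
    rwa [mul_div_cancel₀ _ hL.ne'] at e
  obtain ⟨c₂, L₀, hc₂, hL₀, hdiag⟩ := h.exists_diag_lower hβ hb hN hfD hid'
  obtain ⟨K₁, hK₁, hoff⟩ := h.exists_off_diagonal_le hS hf (half_pos hc₂)
  obtain ⟨E, K₂, hE, hK₂, hsamp⟩ := h.exists_sampling_bound N hp hpp'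
  obtain ⟨Δ, hΔ0, hΔ⟩ : ∃ Δ : ℝ, 0 < Δ ∧ ∀ x z : M, dist x z ≤ Δ :=
    ⟨Metric.diam (univ : Set M) + 1, by linarith [Metric.diam_nonneg (s := (univ : Set M))],
      fun x z => (Metric.dist_le_diam_of_mem isCompact_univ.isBounded (mem_univ x)
        (mem_univ z)).trans (by linarith)⟩
  -- The scale `L = K / q` must be so fine that the matrix is diagonally dominant, and so large
  -- that all times used stay in `(0, 1]`; the latter holds because `q` is at most the diameter.
  set L₁ : ℝ := max L₀ (N + 2 + N : ℕ) with hL₁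
  set K : ℝ := max (max K₁ K₂) (L₁ * Δ) with hK
  have hKpos : 0 < K := lt_max_of_lt_left (lt_max_of_lt_left hK₁)
  have hp0 : p ≠ 0 := (zero_lt_one.trans_le hp).ne'
  have hsum1 : (p⁻¹).toReal = 1 - (p'⁻¹).toReal := by
    have e := hpp'.inv_add_inv_eq_inv
    rw [eq_sub_iff_add_eq, ← ENNReal.toReal_add, e]
    · simp
    · simpa using hp0
    · have : 1 ≤ p' := ENNReal.HolderConjugate.one_le p' p
      simpa using (zero_lt_one.trans_le this).ne'
  refine ⟨2 * E / c₂ * K ^ (β - α * (p'⁻¹).toReal), by positivity, fun C hC a => ?_⟩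
  set q : ℝ := (C : Set M).infsep with hq
  have hqpos : 0 < q := (C.finite_toSet.infsep_pos_iff_nontrivial).2 hC
  have hsep : ∀ x ∈ C, ∀ y ∈ C, x ≠ y → q ≤ dist x y := fun x hx y hy hxy =>
    infsep_le_dist_of_mem hx hy hxy
  have hqΔ : q ≤ Δ := by
    obtain ⟨x, hx, y, hy, hxy⟩ := hC
    exact (hsep x hx y hy hxy).trans (hΔ x y)
  set L : ℝ := K / q with hL
  have hLq : L * q = K := div_mul_cancel₀ _ hqpos.ne'
  have hLL₁ : L₁ ≤ L := by
    rw [hL, le_div_iff₀ hqpos]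
    refine le_trans ?_ (le_max_right _ _)
    have : 0 ≤ L₁ := (zero_le_one.trans hL₀).trans (le_max_left _ _)
    gcongr
  have hLL₀ : L₀ ≤ L := (le_max_left _ _).trans hLL₁
  have hL1 : 1 ≤ L := hL₀.trans hLL₀
  have hL0 : 0 < L := by linarith
  have hNL : ((N + 2 + N : ℕ) : ℝ) ≤ L ^ 2 := by
    have : ((N + 2 + N : ℕ) : ℝ) ≤ L := (le_max_right _ _).trans hLL₁
    nlinarith
  have hLα : 0 < L ^ α := by positivity
  have hLβ : 0 < L ^ (-β) := by positivity
  have hQ := h.isSpectralWeight hL1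
  set m : ℕ → ℝ := fun j => gaussMult ℓ L j ^ (N + 2) * (1 - gaussMult ℓ L j) ^ N with hm
  have hmle : ∀ j, |m j| ≤ 1 * gaussMult ℓ L j := fun j => by
    refine abs_pow_gaussMult_mul_le ℓ L (by omega) j ?_
    have h0 := gaussMult_pos ℓ L j
    have h1 := gaussMult_le_one ℓ L j
    rw [abs_of_nonneg (pow_nonneg (by linarith) N)]
    exact pow_le_one₀ (by linarith) (by linarith)
  set W : M → M → ℝ :=
    multKernel φ (fun j => gaussMult ℓ L j ^ 2 * f L (gaussMult ℓ L j)) with hW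
  have hmb : ∀ x y, multKernel φ (fun j => m j * b (ℓ j)) x y = L ^ (-β) * W x y := by
    intro x y
    rw [hW, ← multKernel_const_mul]
    congr 1
    funext j
    rw [mul_left_comm, ← hid' L hL0 j, hm, mul_pow]
    ring
  have hsampled : eLpNorm (fun x : C => ∫ z, multKernel φ m x z * eignet G C a z ∂μ) p
      Measure.count ≤ ENNReal.ofReal (E * L ^ (α * (p⁻¹).toReal)) * eLpNorm (eignet G C a) p μ :=
    hsamp L hL1 hNL q C hsep ((le_max_right _ _).trans ((le_max_left _ _).trans hLq.ge)) _
      (integrable_eignet hG C a).aestronglyMeasurable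
  have hT : (fun x : C => ∫ z, multKernel φ m x z * eignet G C a z ∂μ) =
      fun x : C => ∑ y : C, a y * (L ^ (-β) * W x y) := by
    funext x
    rw [hQ.integral_mul_eignet h.continuous hmle zero_le_one hG C a]
    simp only [hmb]
  rw [hT] at hsampled
  have hdom := le_eLpNorm_of_diagonally_dominant (ι := C) hp hpp'
    (W := fun x y => L ^ (-β) * W x y) (fun x y => by rw [hW, multKernel_comm])
    (D := L ^ (-β) * (c₂ * L ^ α)) (by positivity)
    (fun x => mul_le_mul_of_nonneg_left (hdiag L hLL₀ x) hLβ.le) (fun x => ?_) a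
  · rw [ofReal_norm_toLp hp]
    have hall := hdom.trans hsampled
    have hD0 : 0 < L ^ (-β) * (c₂ * L ^ α) / 2 := by positivity
    have hconst : 2 * E / c₂ * K ^ (β - α * (p'⁻¹).toReal) * q ^ (α * (p'⁻¹).toReal - β) =
        (L ^ (-β) * (c₂ * L ^ α) / 2)⁻¹ * (E * L ^ (α * (p⁻¹).toReal)) := by
      have e1 : q ^ (α * (p'⁻¹).toReal - β) = (q ^ (β - α * (p'⁻¹).toReal))⁻¹ := by
        rw [← Real.rpow_neg hqpos.le, neg_sub]
      have e2 : K ^ (β - α * (p'⁻¹).toReal) * (q ^ (β - α * (p'⁻¹).toReal))⁻¹ =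
          L ^ (β - α * (p'⁻¹).toReal) := by
        rw [hL, Real.div_rpow hKpos.le hqpos.le, div_eq_mul_inv]
      have e3 : L ^ (β - α * (p'⁻¹).toReal) =
          L ^ (α * (p⁻¹).toReal) * (L ^ (-β) * L ^ α)⁻¹ := by
        rw [← Real.rpow_add hL0, ← Real.rpow_neg hL0.le, ← Real.rpow_add hL0, hsum1]
        congr 1
        ring
      rw [e1, mul_assoc, e2, e3]
      field_simp
    rw [hconst, ENNReal.ofReal_mul (by positivity), ENNReal.ofReal_inv_of_pos hD0, mul_assoc]
    exact (ENNReal.mul_le_iff_le_inv (by simpa using hD0) ENNReal.ofReal_ne_top).1 hall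
  · have h1 := hoff L hL1 q C hsep ((le_max_left _ _).trans ((le_max_left _ _).trans hLq.ge)) x x.2
    rw [← Finset.sum_coe_sort C fun y => if y = (x : M) then 0 else |W x y|] at h1
    calc ∑ y : C, (if y = x then 0 else |L ^ (-β) * W x y|)
        = L ^ (-β) * ∑ y : C, (if (y : M) = x then 0 else |W x y|) := by
          rw [Finset.mul_sum]
          refine Finset.sum_congr rfl fun y _ => ?_
          simp only [Subtype.ext_iff, abs_mul, abs_of_pos hLβ]
          split_ifs <;> simp
      _ ≤ L ^ (-β) * (c₂ / 2 * L ^ α) := by gcongr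
      _ = _ := by ring

end

end Eignet

theorem theorem3p4
    {d : ℕ} {M : Type*} [MetricSpace M] [CompactSpace M] [ConnectedSpace M]
    [ChartedSpace (EuclideanSpace ℝ (Fin d)) M] [IsManifold (𝓡 d) ∞ M]
    [RiemannianBundle (fun x : M => TangentSpace (𝓡 d) x)]
    [IsContMDiffRiemannianBundle (𝓡 d) ∞ (EuclideanSpace ℝ (Fin d))
      (fun x : M => TangentSpace (𝓡 d) x)]
    [IsRiemannianManifold (𝓡 d) M]
    [MeasurableSpace M] [BorelSpace M]
    (μ : Measure M) [IsProbabilityMeasure μ]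
    (φ : ℕ → M → ℝ) (ℓ : ℕ → ℝ) (α : ℝ) (hα : 0 < α)
    (hsys : Eignet.IsDiffusionSystem μ φ ℓ)
    (hball : Eignet.BallUpperBound μ α)
    (hmass : Eignet.HeatMassOne μ φ ℓ)
    (hheat : Eignet.HeatUpperBound φ ℓ α)
    (hgrad : Eignet.HeatGradientBound (d := d) φ ℓ α)
    (hprod : Eignet.ProductAssumption μ φ ℓ)
    (hlow : Eignet.HeatLowerBound φ ℓ α)
    (S : ℕ) (hS : α < S)
    (p p' : ℝ≥0∞) (hp : 1 ≤ p) (hpp' : p.HolderConjugate p')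
    (β : ℝ) (hβ : α * (p'⁻¹).toReal < β)
    (b : ℝ → ℝ) (hb : Eignet.IsMask S β b)
    (G : M → M → ℝ) (hG : Eignet.HasEigExpansion μ φ ℓ b G) :
    ∃ c : ℝ, 0 < c ∧ ∀ (C : Finset M), C.Nontrivial → ∀ a : C → ℝ,
      ENNReal.ofReal ‖WithLp.toLp p a‖ ≤
        ENNReal.ofReal (c * (C : Set M).infsep ^ (α * (p'⁻¹).toReal - β)) *
          eLpNorm (Eignet.eignet G C a) p μ := by
  obtain ⟨c₀, hc₀, hball⟩ := hball
  obtain ⟨γ, κ, hγ, hκ, hheat⟩ := hheat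
  obtain ⟨c₁, hc₁, hlow⟩ := hlow
  have h : Eignet.IsGaussianSystem μ φ ℓ α c₀ κ γ c₁ :=
    { alpha_pos := hα
      ball_pos := hc₀
      kappa_pos := hκ
      gamma_pos := hγ
      low_pos := hc₁
      continuous := hsys.continuous
      orthonormal := hsys.orthonormal
      ell_nonneg := fun j => hsys.ell_zero ▸ hsys.monotone (Nat.zero_le j)
      ball := hball
      summable := fun t ht x y => (hheat t ht x y).1
      upper := fun t ht x y => (hheat t ht x y).2
      mass := hmass
      lower := hlow }
  have hβ0 : 0 < β := lt_of_le_of_lt (by positivity) hβ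
  exact h.exists_coefficient_bound hS hp hpp' hβ0 hb hG
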